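/- Let $n_1,n_2$ be odd primes and let $n_3$ be an even positive integer such that $n_1,n_2,n_3$ are pairwise coprime, $n_2\equiv 1 \pmod{n_1}$, $n_3\equiv 2\pmod{n_1}$ and $n_3\equiv 2\pmod{n_2}$. Let $\psi$ be the real number with $2\pi n_3\psi=\pi/4$, and let $\phi$ be a real number. **Nodes.** Let $J$ be the set of pairs $(k,l)$ of positive integers with $n_2k+n_1l<2n_1n_2$, ordered lexicographically. It parametrizes the nodes of the planar Lissajous curve with frequencies $n_1,n_2$. A node is of type I if $n_1l>n_2k$ and of type II if $n_1l<n_2k$. Put $$a_{kl}=(-1)^{l+1}\frac{\sin(\pi n_3k/n_1)}{\sin(\pi n_2k/n_1)},\qquad \psi_{kl}=2\pi n_3\Big(\frac{l}{2n_2}+\psi\Big)\qquad\text{(type I)},$$ $$a_{kl}=(-1)^{l+1}\frac{\sin\big[2\pi n_3\big(\frac{k}{2n_1}+\phi+\psi\big)\big]}{\sin\big[2\pi n_2\big(\frac{k}{2n_1}+\phi\big)\big]},\qquad \psi_{kl}=\frac{\pi n_3l}{n_2}\qquad\text{(type II)},$$ and $\alpha_{kl}=a_{kl}\sin\psi_{kl}$,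 $\beta_{kl}=a_{kl}\cos\psi_{kl}$. The only quantities that are undefined at $\phi=0$ are those of the type II nodes $(n_1,l)$, whose amplitude has a pole there. Let $J'=\{(k,l)\in J: k\neq n_1\}$. **Wronskian.** Let $S=J$ or $S=J'$ and $m=\#S$. For a real parameter $r$, a nodal curve indexed by $S$ is a family of functions $u_{kl}$, $(k,l)\in S$, analytic at $0$, with $u_{kl}(0)=0$ and $f_{kl}(u_{kl}(\epsilon))=\epsilon$ for $\epsilon$ near $0$, where $f_{kl}(y)=\dfrac{\sin y}{a_{kl}\sin(ry+\psi_{kl})}$. Its Wronskian is $D(r)=\det\big(u_{kl}^{(j)}(0)\big)_{(k,l)\in S,\ 1\le j\le m}$. (The nodal curve of the deformation $t\mapsto(\cos 2\pi n_1t,\ \cos 2\pi n_2(t+\phi)+\epsilon\cos2\pi n_3(t+\phi+\psi))$ corresponds to $r=n_3/n_2$, after the rescaling $u=2\pi n_2 y$.) **The coefficient $D_0$.** Let $$D_0=D_0(S,\phi)=\Big(\prod_{n=1}^m c_n\Big)\det\big(\alpha_{kl},\ \alpha_{kl}\beta_{kl},\ \alpha_{kl}^3,\ \alpha_{kl}^3\beta_{kl},\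 \alpha_{kl}^5,\dots\big)_{(k,l)\in S}\qquad (m\text{ columns}),$$ where $$c_n=\frac{d^{\,n-1}}{dy^{\,n-1}}\Big(\frac{y}{\sin y}\Big)^n\Big|_{y=0}\ (n\text{ odd}),\qquad c_n=n(n-1)\frac{d^{\,n-2}}{dy^{\,n-2}}\Big(\frac{y}{\sin y}\Big)^n\Big|_{y=0}\ (n\text{ even}).$$ **Claim.** 1. For all $\phi\ne0$ sufficiently close to $0$ and $S=J$: a nodal curve exists for every real $r$; its Wronskian $D(r)$ is a polynomial in $r$ with no term of degree less than $\lfloor m/2\rfloor$, the coefficient of $r^{\lfloor m/2\rfloor}$ is $D_0(J,\phi)$, and $D_0(J,\phi)\neq 0$. Moreover $|D_0(J,\phi)|\to\infty$ as $\phi\to0$, $\phi\neq0$. 2. For $\phi=0$ and $S=J'$: again a nodal curve exists for every real $r$, $D(r)$ is a polynomial in $r$ with no term of degree less than $\lfloor m/2\rfloor$, the coefficient of $r^{\lfloor m/2\rfloor}$ is $D_0(J',0)$, and $D_0(J',0)\neq0$. -/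

import Mathlib

open Filter Topology

noncomputable section

namespace LissajousNodes

/-- The nodes of the planar Lissajous curve with frequencies `n₁, n₂`: the pairs `(k, l)` of
positive integers with `n₂ k + n₁ l < 2 n₁ n₂`, in lexicographic order. -/
def nodes (n₁ n₂ : ℕ) : Finset (ℕ ×ₗ ℕ) :=
  ((Finset.range (2 * n₁) ×ˢ Finset.range (2 * n₂)).map toLex.toEmbedding).filter fun P =>
    0 < (ofLex P).1 ∧ 0 < (ofLex P).2 ∧ n₂ * (ofLex P).1 + n₁ * (ofLex P).2 < 2 * n₁ * n₂

/-- The nodes `(k, l)` with `k ≠ n₁`, i.e. those whose amplitude has no pole at `φ = 0`. -/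
def regularNodes (n₁ n₂ : ℕ) : Finset (ℕ ×ₗ ℕ) :=
  (nodes n₁ n₂).filter fun P => (ofLex P).1 ≠ n₁

/-- A node `(k, l)` is of type I if `n₂ k < n₁ l`; every other node is of type II. -/
def IsTypeI (n₁ n₂ : ℕ) (P : ℕ ×ₗ ℕ) : Prop := n₂ * (ofLex P).1 < n₁ * (ofLex P).2

open Classical in
/-- The amplitude `a_{kl}` of a node. -/
def amplitude (n₁ n₂ n₃ : ℕ) (φ ψ : ℝ) (P : ℕ ×ₗ ℕ) : ℝ :=
  let k : ℝ := ((ofLex P).1 : ℝ)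
  let l : ℕ := (ofLex P).2
  if IsTypeI n₁ n₂ P then
    (-1) ^ (l + 1) * (Real.sin (Real.pi * (n₃ * k / n₁)) / Real.sin (Real.pi * (n₂ * k / n₁)))
  else
    (-1) ^ (l + 1) * (Real.sin (2 * Real.pi * n₃ * (k / (2 * n₁) + φ + ψ)) /
      Real.sin (2 * Real.pi * n₂ * (k / (2 * n₁) + φ)))

open Classical in
/-- The phase `ψ_{kl}` of a node. -/
def phase (n₁ n₂ n₃ : ℕ) (ψ : ℝ) (P : ℕ ×ₗ ℕ) : ℝ :=
  let l : ℝ := ((ofLex P).2 : ℝ)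
  if IsTypeI n₁ n₂ P then 2 * Real.pi * n₃ * (l / (2 * n₂) + ψ)
  else 2 * Real.pi * n₃ * (l / (2 * n₂))

/-- `α_{kl} = a_{kl} sin ψ_{kl}` -/
def alpha (n₁ n₂ n₃ : ℕ) (φ ψ : ℝ) (P : ℕ ×ₗ ℕ) : ℝ :=
  amplitude n₁ n₂ n₃ φ ψ P * Real.sin (phase n₁ n₂ n₃ ψ P)

/-- `β_{kl} = a_{kl} cos ψ_{kl}` -/
def beta (n₁ n₂ n₃ : ℕ) (φ ψ : ℝ) (P : ℕ ×ₗ ℕ) : ℝ :=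
  amplitude n₁ n₂ n₃ φ ψ P * Real.cos (phase n₁ n₂ n₃ ψ P)

/-- `u` is the analytic local inverse at `0` of `y ↦ sin y / (a sin (r y + θ))`. -/
structure IsNodalFunction (a θ r : ℝ) (u : ℝ → ℝ) : Prop where
  analyticAt : AnalyticAt ℝ u 0
  map_zero : u 0 = 0
  inverse : ∀ᶠ ε in 𝓝 (0 : ℝ), Real.sin (u ε) / (a * Real.sin (r * u ε + θ)) = ε

/-- `u` is a nodal curve (with parameter `r`) whose coordinates are indexed by the set `S`. For
`r = n₃ / n₂`, `u_{kl} / (2 π n₂)` is the displacement of a parameter of the node `(k, l)` of the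
deformation `t ↦ (cos 2πn₁t, cos 2πn₂(t+φ) + ε cos 2πn₃(t+φ+ψ))` of the Lissajous curve. -/
def IsNodalCurve (n₁ n₂ n₃ : ℕ) (φ ψ : ℝ) (S : Finset (ℕ ×ₗ ℕ)) (r : ℝ)
    (u : ℕ ×ₗ ℕ → ℝ → ℝ) : Prop :=
  ∀ P ∈ S, IsNodalFunction (amplitude n₁ n₂ n₃ φ ψ P) (phase n₁ n₂ n₃ ψ P) r (u P)

/-- The Wronskian at `ε = 0`: the determinant of the derivatives of orders `1, …, #S` of the
coordinates, the rows being in lexicographic order. -/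
def wronskian (S : Finset (ℕ ×ₗ ℕ)) (u : ℕ ×ₗ ℕ → ℝ → ℝ) : ℝ :=
  (Matrix.of fun i j : Fin S.card =>
    iteratedDeriv ((j : ℕ) + 1) (u (S.orderEmbOfFin rfl i)) 0).det

/-- The coefficients `c_n`, where `y / sin y` is written as the inverse of
`Real.sinc y = sin y / y` (equal to `1` at `0`). -/
def lagrangeCoeff (n : ℕ) : ℝ :=
  if Odd n then iteratedDeriv (n - 1) (fun y : ℝ => (Real.sinc y)⁻¹ ^ n) 0
  else n * (n - 1) * iteratedDeriv (n - 2) (fun y : ℝ => (Real.sinc y)⁻¹ ^ n) 0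

/-- The product of `c_1, …, c_m` with the determinant whose rows, in lexicographic order, are
`(α, α β, α³, α³ β, α⁵, …)`, where `m = #S`. -/
def lowestCoeff (n₁ n₂ n₃ : ℕ) (φ ψ : ℝ) (S : Finset (ℕ ×ₗ ℕ)) : ℝ :=
  (∏ n ∈ Finset.Icc 1 S.card, lagrangeCoeff n) *
    (Matrix.of fun i j : Fin S.card =>
      let P := S.orderEmbOfFin rfl i
      if Even (j : ℕ) then alpha n₁ n₂ n₃ φ ψ P ^ ((j : ℕ) + 1)
      else alpha n₁ n₂ n₃ φ ψ P ^ (j : ℕ) * beta n₁ n₂ n₃ φ ψ P).det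

/-- For every `r` there is a nodal curve; its Wronskian is a polynomial `D` in `r` without terms
of degree less than `d`, and the coefficient of `r ^ d` in `D` is `c`. -/
def WronskianHasLowestTerm (n₁ n₂ n₃ : ℕ) (φ ψ : ℝ) (S : Finset (ℕ ×ₗ ℕ)) (d : ℕ) (c : ℝ) :
    Prop :=
  (∀ r : ℝ, ∃ u, IsNodalCurve n₁ n₂ n₃ φ ψ S r u) ∧
    ∃ D : Polynomial ℝ,
      (∀ (r : ℝ) (u : ℕ ×ₗ ℕ → ℝ → ℝ), IsNodalCurve n₁ n₂ n₃ φ ψ S r u →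
        wronskian S u = D.eval r) ∧
      (∀ i < d, D.coeff i = 0) ∧ D.coeff d = c

end LissajousNodes

end

/-! A nodal function solves u = ε g(u) with g(y) = (α cos ry + β sin ry) · y/sin y, so Lagrange
inversion gives u⁽ⁿ⁾(0) as the (n-1)-st derivative of gⁿ at 0. By Leibniz's rule this is a
polynomial in r. Since y/sin y is even, its constant term is c_n αⁿ for odd n and zero for even n,
where the linear term has coefficient c_n αⁿ⁻¹β. Extracting one factor r from each column of even
order n leaves D₀ as the coefficient of r^⌊m/2⌋. The differential equation of sin⁻ⁿ shows that no
c_n vanishes.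

The nodes come in pairs with equal α² and opposite β (`alpha_beta_partner`). With one representative
per pair, |D₀| factors as |∏ c_n| times the product of all 2α²|β| times the square of the
Vandermonde determinant of the values α² (`abs_det_of_pairing`). It remains to see that α, β ≠ 0 and
that the α² of the representatives are distinct.

At φ = 0 the congruences and 2πn₃ψ = π/4 turn α² into (1 + cos(2πk/n₁))(1 + sin(4πl/n₂)) for type I
and (1 + sin(4πk/n₁))/(1 - cos(2πk/n₁)) · (1 - cos(4πl/n₂))/2 for type II. The automorphism i ↦ -i
that fixes the roots of unity of order n₁n₂ keeps these cosines and negates these sines, which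
separates equal values within a type. Squaring the n₂-th roots of unity while fixing the n₁-th ones
excludes a coincidence between the types, because n₂ ≠ 3 (`alpha_sq_injective`).

As φ → 0 the amplitudes at the nodes (n₁, l) blow up. Every factor of |D₀| stays bounded below by a
positive constant and at least one diverges, so |D₀| → ∞; in particular D₀ ≠ 0 near 0. -/

noncomputable section

namespace LissajousNodes

/-! ### Formal Taylor series and Lagrange inversion. -/

open PowerSeries in
/-- The Taylor series of a function at `0`. -/
def taylorSeries (f : ℝ → ℝ) : ℝ⟦X⟧ :=
  PowerSeries.mk fun n => iteratedDeriv n f 0 / n.factorial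

namespace taylorSeries

open PowerSeries

theorem coeff_eq (f : ℝ → ℝ) (n : ℕ) :
    coeff n (taylorSeries f) = iteratedDeriv n f 0 / n.factorial := by
  simp [taylorSeries]

theorem iteratedDeriv_eq (f : ℝ → ℝ) (n : ℕ) :
    iteratedDeriv n f 0 = n.factorial * coeff n (taylorSeries f) := by
  rw [coeff_eq]; field_simp

theorem congr {f g : ℝ → ℝ} (h : f =ᶠ[𝓝 0] g) : taylorSeries f = taylorSeries g := by
  ext n
  rw [coeff_eq, coeff_eq, h.iteratedDeriv_eq n]

theorem mul {f g : ℝ → ℝ} (hf : AnalyticAt ℝ f 0) (hg : AnalyticAt ℝ g 0) :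
    taylorSeries (fun x => f x * g x) = taylorSeries f * taylorSeries g := by
  ext n
  rw [coeff_mul, coeff_eq, iteratedDeriv_fun_mul hf.contDiffAt hg.contDiffAt,
    Finset.Nat.sum_antidiagonal_eq_sum_range_succ
      fun i j => coeff i (taylorSeries f) * coeff j (taylorSeries g), Finset.sum_div]
  refine Finset.sum_congr rfl fun i hi => ?_
  have hi' : i ≤ n := Nat.lt_succ_iff.1 (Finset.mem_range.1 hi)
  rw [coeff_eq, coeff_eq, Nat.cast_choose ℝ hi']
  field_simp

theorem const (c : ℝ) : taylorSeries (fun _ => c) = C c := by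
  ext n
  rw [coeff_eq, iteratedDeriv_const, coeff_C]
  split_ifs with h <;> simp [h]

theorem pow {f : ℝ → ℝ} (hf : AnalyticAt ℝ f 0) (n : ℕ) :
    taylorSeries (fun x => f x ^ n) = taylorSeries f ^ n := by
  induction n with
  | zero => simpa using const 1
  | succ n ih => simp only [pow_succ, mul (hf.fun_pow n) hf, ih]

theorem id' : taylorSeries (fun x => x) = X := by
  ext n
  rw [coeff_eq, iteratedDeriv_fun_id_zero, coeff_X]
  split_ifs with h <;> simp [h]

theorem add {f g : ℝ → ℝ} (hf : AnalyticAt ℝ f 0) (hg : AnalyticAt ℝ g 0) :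
    taylorSeries (fun x => f x + g x) = taylorSeries f + taylorSeries g := by
  ext n
  simp only [map_add, coeff_eq, iteratedDeriv_fun_add hf.contDiffAt hg.contDiffAt, add_div]

theorem sum {ι : Type*} (s : Finset ι) {f : ι → ℝ → ℝ} (hf : ∀ i ∈ s, AnalyticAt ℝ (f i) 0) :
    taylorSeries (fun x => ∑ i ∈ s, f i x) = ∑ i ∈ s, taylorSeries (f i) := by
  classical
  induction s using Finset.induction_on with
  | empty => simpa using const 0
  | insert a s ha ih =>
    simp only [Finset.sum_insert ha]
    rw [add (hf a (by simp)) (Finset.analyticAt_fun_sum _ fun i hi => hf i (by simp [hi])),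
      ih fun i hi => hf i (by simp [hi])]

theorem derivative (f : ℝ → ℝ) : d⁄dX ℝ (taylorSeries f) = taylorSeries (deriv f) := by
  ext n
  rw [coeff_derivative, coeff_eq, coeff_eq, iteratedDeriv_succ', Nat.factorial_succ]
  push_cast
  field_simp

theorem id_mul {f : ℝ → ℝ} (hf : AnalyticAt ℝ f 0) :
    taylorSeries (fun x => x * f x) = X * taylorSeries f := by
  rw [← id']
  exact mul analyticAt_id hf

end taylorSeries

open PowerSeries in
theorem coeff_X_mul_derivative (f : ℝ⟦X⟧) (n : ℕ) : coeff n (X * d⁄dX ℝ f) = n * coeff n f := by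
  cases n with
  | zero => simp
  | succ n => rw [coeff_succ_X_mul, coeff_derivative]; push_cast; ring

open PowerSeries in
/-- The residue of `u' / u ^ (i + 1)` where `u = X * V` and `V` is a unit with inverse `W`. -/
theorem coeff_inv_pow_mul_derivative {V W : ℝ⟦X⟧} (h : W * V = 1) (i : ℕ) :
    coeff i (W ^ (i + 1) * d⁄dX ℝ (X * V)) = if i = 0 then 1 else 0 := by
  have hD : d⁄dX ℝ (X * V) = V + X * d⁄dX ℝ V := by
    rw [Derivation.leibniz]; simp; ring
  have hW : d⁄dX ℝ W = - (W ^ 2 * d⁄dX ℝ V) := by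
    have := congrArg (d⁄dX ℝ) h
    rw [Derivation.leibniz] at this
    simp only [smul_eq_mul, derivative_one] at this
    linear_combination (-d⁄dX ℝ W) * h + W * this
  rcases i with _ | i
  · rw [hD]
    simp only [zero_add, pow_one, if_true, mul_add, h]
    simp
  -- This is the derivative of u^-(i+1) multiplied by a power of X, which avoids Laurent series. On
  -- the right the two coefficients of degree i + 1 cancel: a derivative has no residue.
  · have key : (C ((i : ℝ) + 1)) * (W ^ (i + 1 + 1) * d⁄dX ℝ (X * V)) =
        C ((i : ℝ) + 1) * W ^ (i + 1) - X * d⁄dX ℝ (W ^ (i + 1)) := by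
      rw [derivative_pow, hW, hD]
      simp only [Nat.add_sub_cancel, map_add, map_natCast, map_one]
      push_cast
      linear_combination ((i : ℝ⟦X⟧) + 1) * W ^ (i + 1) * h
    have := congrArg (coeff (i + 1)) key
    rw [map_sub, coeff_X_mul_derivative, coeff_C_mul, coeff_C_mul] at this
    have hi : (i : ℝ) + 1 ≠ 0 := by positivity
    push_cast at this
    simpa [hi] using this

open PowerSeries in
/-- The **Lagrange inversion formula**: the derivatives at `0` of an analytic solution of
`u ε = ε * g (u ε)`. -/
theorem iteratedDeriv_of_eq_mul_comp {u g : ℝ → ℝ} (hu : AnalyticAt ℝ u 0) (hu0 : u 0 = 0)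
    (hg : AnalyticAt ℝ g 0) (hg0 : g 0 ≠ 0) (h : ∀ᶠ ε in 𝓝 (0 : ℝ), u ε = ε * g (u ε)) (n : ℕ) :
    iteratedDeriv (n + 1) u 0 = iteratedDeriv n (fun y => g y ^ (n + 1)) 0 := by
  have comp : ∀ {F : ℝ → ℝ}, AnalyticAt ℝ F 0 → AnalyticAt ℝ (fun ε => F (u ε)) 0 := by
    intro F hF
    exact AnalyticAt.fun_comp (by rwa [hu0]) hu
  -- A finite expansion with remainder suffices, so no infinite series has to be composed with u.
  obtain ⟨R, hR, hgR⟩ := (hg.fun_pow (n + 1)).exists_eventuallyEq_sum_add_pow_mul (n + 1)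
  set c : ℕ → ℝ := fun k => iteratedDeriv k (fun y => g y ^ (n + 1)) 0 / k.factorial with hc
  set V := taylorSeries fun ε => g (u ε) with hV
  have hU : taylorSeries u = X * V := by
    rw [taylorSeries.congr h, taylorSeries.id_mul (comp hg)]
  have hW : V⁻¹ * V = 1 := by
    refine PowerSeries.inv_mul_cancel _ ?_
    rw [← coeff_zero_eq_constantCoeff_apply, taylorSeries.coeff_eq]
    simpa [hu0] using hg0
  have hVn : V ^ (n + 1) = ∑ k ∈ Finset.range (n + 1), C (c k) * (X * V) ^ k +
      (X * V) ^ (n + 1) * taylorSeries fun ε => R (u ε) := by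
    rw [← taylorSeries.pow (comp hg), ← hU]
    have hev : (fun ε => g (u ε) ^ (n + 1)) =ᶠ[𝓝 0]
        fun ε => ∑ k ∈ Finset.range (n + 1), c k * u ε ^ k + u ε ^ (n + 1) * R (u ε) := by
      have htend : Tendsto u (𝓝 0) (𝓝 0) := by simpa [hu0] using hu.continuousAt.tendsto
      filter_upwards [htend.eventually hgR] with ε hε
      rw [hε]
      simp only [smul_eq_mul, hc]
      congr 1
      exact Finset.sum_congr rfl fun k _ => by ring
    have ha : ∀ k, AnalyticAt ℝ (fun ε => c k * u ε ^ k) 0 := fun k =>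
      analyticAt_const.fun_mul (hu.fun_pow k)
    rw [taylorSeries.congr hev, taylorSeries.add (Finset.analyticAt_fun_sum _ fun k _ => ha k)
      ((hu.fun_pow _).fun_mul (comp hR)), taylorSeries.mul (hu.fun_pow _) (comp hR),
      taylorSeries.pow hu, taylorSeries.sum _ fun k _ => ha k]
    congr 1
    refine Finset.sum_congr rfl fun k _ => ?_
    rw [taylorSeries.mul analyticAt_const (hu.fun_pow k), taylorSeries.const,
      taylorSeries.pow hu]
  have hWn : ∀ k, V⁻¹ ^ k * V ^ k = 1 := fun k => by rw [← mul_pow, hW, one_pow]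
  -- After multiplication by u'/V^(n+1), the coefficient of degree n sees only the term k = n: lower
  -- terms have zero residue, and the remainder starts in degree n + 1.
  have hDU : d⁄dX ℝ (X * V) = ∑ k ∈ Finset.range (n + 1),
      C (c k) * (X ^ k * (V⁻¹ ^ (n - k + 1) * d⁄dX ℝ (X * V))) +
      X ^ (n + 1) * ((taylorSeries fun ε => R (u ε)) * d⁄dX ℝ (X * V)) := by
    have := congrArg (fun f => V⁻¹ ^ (n + 1) * d⁄dX ℝ (X * V) * f) hVn
    simp only [mul_add, Finset.mul_sum] at this
    calc d⁄dX ℝ (X * V) = V⁻¹ ^ (n + 1) * d⁄dX ℝ (X * V) * V ^ (n + 1) := by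
          linear_combination (-d⁄dX ℝ (X * V)) * hWn (n + 1)
      _ = _ := by
          rw [this]
          congr 1
          · refine Finset.sum_congr rfl fun k hk => ?_
            have hk' : k ≤ n := Nat.lt_succ_iff.1 (Finset.mem_range.1 hk)
            have e : V⁻¹ ^ (n + 1) = V⁻¹ ^ (n - k + 1) * V⁻¹ ^ k := by
              rw [← pow_add]; congr 1; omega
            rw [e, mul_pow]
            linear_combination (C (c k) * X ^ k * V⁻¹ ^ (n - k + 1) * d⁄dX ℝ (X * V)) * hWn k
          · rw [mul_pow]
            linear_combination (X ^ (n + 1) * (taylorSeries fun ε => R (u ε)) *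
              d⁄dX ℝ (X * V)) * hWn (n + 1)
  have hcoeff := congrArg (coeff n) hDU
  rw [map_add, map_sum, coeff_X_pow_mul', if_neg (by omega), add_zero,
    Finset.sum_eq_single_of_mem n (by simp), coeff_C_mul, coeff_X_pow_mul', if_pos le_rfl,
    Nat.sub_self, coeff_inv_pow_mul_derivative hW, if_pos rfl, mul_one, ← hU, coeff_derivative,
    taylorSeries.coeff_eq] at hcoeff
  · rw [hc] at hcoeff
    simp only [Nat.factorial_succ] at hcoeff
    push_cast at hcoeff
    field_simp at hcoeff
    exact hcoeff
  · intro k hk hkn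
    have hk' : k < n := by have := Finset.mem_range.1 hk; omega
    rw [coeff_C_mul, coeff_X_pow_mul', if_pos hk'.le, coeff_inv_pow_mul_derivative hW,
      if_neg (by omega), mul_zero]

/-! ### The function y / sin y and the constants c_n. -/

theorem analyticAt_sinc_zero : AnalyticAt ℝ Real.sinc 0 := by
  obtain ⟨p, hp⟩ := (Real.analyticAt_sin : AnalyticAt ℝ Real.sin 0)
  rw [Real.sinc_eq_dslope]
  exact ⟨_, hp.has_fpower_series_dslope_fslope⟩

theorem analyticAt_inv_sinc_zero : AnalyticAt ℝ (fun y => (Real.sinc y)⁻¹) 0 :=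
  analyticAt_sinc_zero.fun_inv (by simp)

theorem mul_sinc (y : ℝ) : y * Real.sinc y = Real.sin y := by
  by_cases hy : y = 0
  · simp [hy]
  · rw [Real.sinc_of_ne_zero hy]; field_simp

theorem iteratedDeriv_inv_sinc_pow_odd (n k : ℕ) (hk : Odd k) :
    iteratedDeriv k (fun y : ℝ => (Real.sinc y)⁻¹ ^ n) 0 = 0 := by
  have h := iteratedDeriv_comp_neg k (fun y : ℝ => (Real.sinc y)⁻¹ ^ n) 0
  simp only [Real.sinc_neg, hk.neg_one_pow, neg_zero, neg_smul, one_smul] at h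
  linarith

open PowerSeries in
/-- The recursion for the Taylor coefficients of `(y / sin y) ^ n` that comes from the
differential equation `(sin⁻ⁿ)'' = n (n + 1) sin⁻ⁿ⁻² - n² sin⁻ⁿ`. -/
theorem coeff_inv_sinc_pow (n N : ℕ) :
    ((N : ℝ) + 2 - n) * ((N : ℝ) + 2 - n - 1) *
      coeff (N + 2) (taylorSeries (fun y : ℝ => (Real.sinc y)⁻¹) ^ n) =
    n * (n + 1) * coeff (N + 2) (taylorSeries (fun y : ℝ => (Real.sinc y)⁻¹) ^ (n + 2)) -
      n ^ 2 * coeff N (taylorSeries (fun y : ℝ => (Real.sinc y)⁻¹) ^ n) := by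
  set H := taylorSeries (fun y : ℝ => (Real.sinc y)⁻¹) with hH
  set S := taylorSeries Real.sinc with hS
  set c := taylorSeries Real.cos with hc
  have hs : X * S = taylorSeries Real.sin := by
    rw [hS, ← taylorSeries.id_mul analyticAt_sinc_zero]
    simp only [mul_sinc]
  have hHS : H * S = 1 := by
    rw [hH, hS, ← taylorSeries.mul analyticAt_inv_sinc_zero analyticAt_sinc_zero,
      ← map_one C, ← taylorSeries.const]
    apply taylorSeries.congr
    have : ∀ᶠ y in 𝓝 (0 : ℝ), Real.sinc y ≠ 0 :=
      Real.continuous_sinc.continuousAt.eventually_ne (by simp)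
    filter_upwards [this] with y hy
    field_simp
  have hcs : c ^ 2 + (X * S) ^ 2 = 1 := by
    rw [hs, hc, ← taylorSeries.pow Real.analyticAt_cos, ← taylorSeries.pow Real.analyticAt_sin,
      ← taylorSeries.add (Real.analyticAt_cos.fun_pow _) (Real.analyticAt_sin.fun_pow _)]
    simp only [Real.cos_sq_add_sin_sq]
    rw [taylorSeries.const, map_one]
  have hDs : S + X * d⁄dX ℝ S = c := by
    have : d⁄dX ℝ (X * S) = c := by rw [hs, taylorSeries.derivative, Real.deriv_sin]
    rw [Derivation.leibniz] at this
    rw [← this]; simp; ring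
  have hDc : d⁄dX ℝ c = - (X * S) := by
    rw [hs, hc, taylorSeries.derivative, Real.deriv_cos']
    ext k
    rw [map_neg, taylorSeries.coeff_eq, taylorSeries.coeff_eq, iteratedDeriv_fun_neg, neg_div]
  have hDH : X * d⁄dX ℝ H = H - H ^ 2 * c := by
    have := congrArg (d⁄dX ℝ) hHS
    rw [Derivation.leibniz] at this
    simp only [smul_eq_mul, derivative_one] at this
    linear_combination (X * H) * this - H ^ 2 * hDs + (H - X * d⁄dX ℝ H) * hHS
  have hpow : ∀ n : ℕ, X * d⁄dX ℝ (H ^ n) = (n : ℝ⟦X⟧) * H ^ n - (n : ℝ⟦X⟧) * (H ^ (n + 1) * c) := by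
    intro n
    rcases n with _ | n
    · simp
    · rw [derivative_pow]
      simp only [Nat.add_sub_cancel]
      linear_combination (((n + 1 : ℕ) : ℝ⟦X⟧) * H ^ n) * hDH
  have h2 : X * d⁄dX ℝ (X * d⁄dX ℝ (H ^ n)) = (n : ℝ⟦X⟧) ^ 2 * H ^ n - ((n : ℝ⟦X⟧) ^ 2 + (n : ℝ⟦X⟧) * ((n : ℝ⟦X⟧) + 1)) *
      (H ^ (n + 1) * c) + (n : ℝ⟦X⟧) * ((n : ℝ⟦X⟧) + 1) * H ^ (n + 2) - (n : ℝ⟦X⟧) ^ 2 * (X ^ 2 * H ^ n) := by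
    have e : d⁄dX ℝ (X * d⁄dX ℝ (H ^ n)) = (n : ℝ⟦X⟧) * d⁄dX ℝ (H ^ n) -
        (n : ℝ⟦X⟧) * (d⁄dX ℝ (H ^ (n + 1)) * c + H ^ (n + 1) * d⁄dX ℝ c) := by
      rw [hpow, map_sub, Derivation.leibniz, Derivation.leibniz, Derivation.leibniz,
        Derivation.map_natCast]
      simp only [smul_eq_mul, mul_zero, add_zero]
      ring
    rw [e, hDc]
    have h1 := hpow (n + 1)
    push_cast at h1
    linear_combination (n : ℝ⟦X⟧) * hpow n - (n : ℝ⟦X⟧) * c * h1 + ((n : ℝ⟦X⟧) * ((n : ℝ⟦X⟧) + 1) * H ^ (n + 2)) * hcs -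
      ((n : ℝ⟦X⟧) * ((n : ℝ⟦X⟧) + 1) * X ^ 2 * H ^ n * (H * S + 1) - (n : ℝ⟦X⟧) * X ^ 2 * H ^ n) * hHS
  -- With θ = X d/dX, the left side is (θ - n)(θ - n - 1)Hⁿ, that is, Xⁿ⁺² times the second
  -- derivative of sin⁻ⁿ = X⁻ⁿHⁿ.
  have key : X * d⁄dX ℝ (X * d⁄dX ℝ (H ^ n)) - C (2 * n + 1 : ℝ) * (X * d⁄dX ℝ (H ^ n)) +
      C ((n : ℝ) * (n + 1)) * H ^ n =
      C ((n : ℝ) * (n + 1)) * H ^ (n + 2) - C ((n : ℝ) ^ 2) * (X ^ 2 * H ^ n) := by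
    rw [h2, hpow]
    simp only [map_add, map_mul, map_pow, map_natCast, map_one, map_ofNat]
    ring
  have := congrArg (coeff (N + 2)) key
  rw [map_add, map_sub, map_sub] at this
  simp only [coeff_C_mul, coeff_X_mul_derivative, coeff_X_pow_mul] at this
  push_cast at this
  linear_combination this

-- For N = 2n and exponent 2n + 1 or 2n + 2 the left side of `coeff_inv_sinc_pow` vanishes. Raising
-- both degree and exponent by 2 then multiplies the coefficient by a positive number.
open PowerSeries in
theorem coeff_inv_sinc_pow_pos (n : ℕ) :
    0 < coeff (2 * n) (taylorSeries (fun y : ℝ => (Real.sinc y)⁻¹) ^ (2 * n + 1)) ∧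
    0 < coeff (2 * n) (taylorSeries (fun y : ℝ => (Real.sinc y)⁻¹) ^ (2 * n + 2)) := by
  induction n with
  | zero =>
    have : coeff 0 (taylorSeries (fun y : ℝ => (Real.sinc y)⁻¹)) = 1 := by
      simp [taylorSeries.coeff_eq]
    rw [coeff_zero_eq_constantCoeff_apply] at this
    simp [this]
  | succ n ih =>
    have h1 := coeff_inv_sinc_pow (2 * n + 1) (2 * n)
    have h2 := coeff_inv_sinc_pow (2 * n + 2) (2 * n)
    have e1 : 2 * (n + 1) = 2 * n + 2 := by ring
    rw [e1, show 2 * n + 2 + 1 = 2 * n + 1 + 2 by ring]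
    push_cast at h1 h2
    refine ⟨pos_of_mul_pos_right (a := (2 * n + 1 : ℝ) * (2 * n + 1 + 1)) ?_ (by positivity),
      pos_of_mul_pos_right (a := (2 * n + 2 : ℝ) * (2 * n + 2 + 1)) ?_ (by positivity)⟩
    · have := mul_pos (by positivity : (0 : ℝ) < (2 * n + 1) ^ 2) ih.1
      linear_combination this + h1
    · have := mul_pos (by positivity : (0 : ℝ) < (2 * n + 2) ^ 2) ih.2
      linear_combination this + h2

theorem lagrangeCoeff_ne_zero {n : ℕ} (hn : n ≠ 0) : lagrangeCoeff n ≠ 0 := by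
  unfold lagrangeCoeff
  rcases Nat.even_or_odd' n with ⟨k, rfl | rfl⟩
  · obtain ⟨k, rfl⟩ : ∃ j, k = j + 1 := ⟨k - 1, by omega⟩
    rw [if_neg (by simp), show 2 * (k + 1) - 2 = 2 * k by omega, taylorSeries.iteratedDeriv_eq,
      taylorSeries.pow analyticAt_inv_sinc_zero]
    have h1 := (coeff_inv_sinc_pow_pos k).2
    have h2 : (2 : ℝ) * (k + 1) - 1 ≠ 0 := by
      have : (0 : ℝ) ≤ k := k.cast_nonneg
      intro h; linarith
    have h3 : ((k : ℝ) + 1) ≠ 0 := by positivity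
    rw [show 2 * (k + 1) = 2 * k + 2 by ring] at *
    push_cast
    refine mul_ne_zero (mul_ne_zero (by positivity) ?_)
      (mul_ne_zero (by positivity) h1.ne')
    intro h; apply h2; linarith
  · rw [if_pos (by simp), show 2 * k + 1 - 1 = 2 * k by omega, taylorSeries.iteratedDeriv_eq,
      taylorSeries.pow analyticAt_inv_sinc_zero]
    exact mul_ne_zero (by positivity) (coeff_inv_sinc_pow_pos k).1.ne'

/-! ### Lowest terms of determinants of polynomials. -/

open Polynomial in
/-- If the entries of column `j` are divisible by `X ^ e j`, the lowest term of the determinant is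
the determinant of the lowest terms. -/
theorem coeff_det_of_coeff_eq_zero {m : ℕ} (M : Matrix (Fin m) (Fin m) ℝ[X]) (e : Fin m → ℕ)
    (h : ∀ i j, ∀ k < e j, (M i j).coeff k = 0) :
    (∀ k < ∑ j, e j, M.det.coeff k = 0) ∧
      M.det.coeff (∑ j, e j) = (Matrix.of fun i j => (M i j).coeff (e j)).det := by
  have hdvd : ∀ i j, ∃ q, M i j = X ^ e j * q := fun i j => X_pow_dvd_iff.2 (h i j)
  choose Q hQ using hdvd
  have hM : M.det = X ^ (∑ j, e j) * (Matrix.of Q).det := by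
    rw [← Finset.prod_pow_eq_pow_sum, ← Matrix.det_mul_row]
    congr 1
    ext1 i j
    exact hQ i j
  refine ⟨fun k hk => ?_, ?_⟩
  · rw [hM, coeff_X_pow_mul', if_neg (by omega)]
  · rw [hM, coeff_X_pow_mul', if_pos le_rfl, Nat.sub_self, coeff_zero_eq_eval_zero,
      ← coe_evalRingHom, RingHom.map_det]
    congr 1
    ext1 i j
    simp [hQ, coeff_X_pow_mul', coeff_zero_eq_eval_zero]

theorem sum_ite_even (m : ℕ) : ∑ j : Fin m, (if Even (j : ℕ) then 0 else 1) = m / 2 := by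
  rw [Fin.sum_univ_eq_sum_range fun j => if Even j then 0 else 1]
  induction m with
  | zero => simp
  | succ m ih =>
    rw [Finset.sum_range_succ, ih]
    rcases Nat.even_or_odd' m with ⟨k, rfl | rfl⟩
    · simp; omega
    · simp; omega

theorem prod_Icc_one_eq_prod_fin (f : ℕ → ℝ) (m : ℕ) :
    ∏ n ∈ Finset.Icc 1 m, f n = ∏ j : Fin m, f (j + 1) := by
  rw [Fin.prod_univ_eq_prod_range fun j => f (j + 1)]
  induction m with
  | zero => simp
  | succ m ih => rw [Finset.prod_Icc_succ_top (by omega), Finset.prod_range_succ, ih]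

/-! ### Nodal functions and their Wronskian as a polynomial in r. -/

/-- A nodal function exists, since the function to be inverted has derivative
`1 / (a * sin θ) ≠ 0` at `0`. -/
theorem exists_isNodalFunction {a θ : ℝ} (h : a * Real.sin θ ≠ 0) (r : ℝ) :
    ∃ u, IsNodalFunction a θ r u := by
  set f : ℝ → ℝ := fun y => Real.sin y / (a * Real.sin (r * y + θ)) with hf
  have hden : a * Real.sin (r * 0 + θ) ≠ 0 := by simpa using h
  have han : AnalyticAt ℝ f 0 := by
    refine AnalyticAt.fun_div Real.analyticAt_sin ?_ hden
    exact analyticAt_const.fun_mul (Real.analyticAt_sin.fun_comp (by fun_prop))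
  have hderiv : HasDerivAt f (a * Real.sin θ)⁻¹ 0 := by
    have h1 := (Real.hasDerivAt_sin 0).div (((Real.hasDerivAt_sin (r * 0 + θ)).comp 0
      (((hasDerivAt_id (0 : ℝ)).const_mul r).add_const θ)).const_mul a) (by simpa using h)
    refine h1.congr_deriv ?_
    simp
    field_simp
  have hstrict : HasStrictDerivAt f (a * Real.sin θ)⁻¹ 0 := by
    have := han.hasStrictDerivAt
    rwa [hderiv.deriv] at this
  have hf0 : f 0 = 0 := by simp [hf]
  have hne : (a * Real.sin θ)⁻¹ ≠ 0 := inv_ne_zero h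
  have hcd : ContDiffAt ℝ ⊤ f 0 := han.contDiffAt
  have hfd : HasFDerivAt f (ContinuousLinearEquiv.unitsEquivAut ℝ (Units.mk0 _ hne) : ℝ →L[ℝ] ℝ) 0 :=
    hderiv.hasFDerivAt_equiv hne
  have hsf := hcd.hasStrictFDerivAt' hfd (by simp)
  refine ⟨hcd.localInverse hfd (by simp), ?_, ?_, ?_⟩
  · have := hcd.to_localInverse hfd (by simp)
    rw [hf0] at this
    exact this.analyticAt
  · have := hcd.localInverse_apply_image hfd (by simp)
    rwa [hf0] at this
  · have := hsf.eventually_right_inverse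
    rw [hf0] at this
    exact this

/-- The derivatives of a nodal function at `0`. -/
theorem IsNodalFunction.iteratedDeriv_eq {a θ r : ℝ} {u : ℝ → ℝ} (hu : IsNodalFunction a θ r u)
    (h : a * Real.sin θ ≠ 0) (n : ℕ) :
    iteratedDeriv (n + 1) u 0 = iteratedDeriv n (fun y => (a * Real.sin θ * Real.cos (r * y) +
      a * Real.cos θ * Real.sin (r * y)) ^ (n + 1) * (Real.sinc y)⁻¹ ^ (n + 1)) 0 := by
  have hsin : ∀ y, a * Real.sin θ * Real.cos (r * y) + a * Real.cos θ * Real.sin (r * y) =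
      a * Real.sin (r * y + θ) := fun y => by rw [Real.sin_add]; ring
  simp only [hsin, ← mul_pow]
  have hcont : ContinuousAt u 0 := hu.analyticAt.continuousAt
  refine iteratedDeriv_of_eq_mul_comp hu.analyticAt hu.map_zero ?_ (by simpa using h) ?_ n
  · exact (analyticAt_const.fun_mul (Real.analyticAt_sin.fun_comp (by fun_prop))).fun_mul
      analyticAt_inv_sinc_zero
  -- Near 0 both denominators are nonzero, so the inverse relation can be rewritten as u = ε g(u).
  · have h1 : ∀ᶠ ε in 𝓝 (0 : ℝ), a * Real.sin (r * u ε + θ) ≠ 0 := by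
      refine ContinuousAt.eventually_ne ?_ (by simpa [hu.map_zero] using h)
      exact continuousAt_const.mul (Real.continuous_sin.continuousAt.comp
        ((continuousAt_const.mul hcont).add continuousAt_const))
    have h2 : ∀ᶠ ε in 𝓝 (0 : ℝ), Real.sinc (u ε) ≠ 0 :=
      (Real.continuous_sinc.continuousAt.comp hcont).eventually_ne (by simp [hu.map_zero])
    filter_upwards [h1, h2, hu.inverse] with ε e1 e2 e3
    rw [div_eq_iff e1, ← mul_sinc] at e3
    rw [← mul_assoc, ← e3]
    field_simp

open Polynomial in
/-- The derivative of order `n + 1` at `0` of the coordinate of a nodal curve, as a polynomial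
in `r`. -/
def nodalDerivPoly (α β : ℝ) (n : ℕ) : ℝ[X] :=
  ∑ k ∈ Finset.range (n + 1), C (n.choose k *
    iteratedDeriv k (fun x => (α * Real.cos x + β * Real.sin x) ^ (n + 1)) 0 *
    iteratedDeriv (n - k) (fun y => (Real.sinc y)⁻¹ ^ (n + 1)) 0) * X ^ k

/-- In Leibniz's rule the k-th derivative of the trigonometric factor, a function of ry, contributes
r ^ k; the power of y / sin y does not involve r. -/
theorem IsNodalFunction.iteratedDeriv_eq_eval {a θ r : ℝ} {u : ℝ → ℝ}
    (hu : IsNodalFunction a θ r u) (h : a * Real.sin θ ≠ 0) (n : ℕ) :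
    iteratedDeriv (n + 1) u 0 =
      (nodalDerivPoly (a * Real.sin θ) (a * Real.cos θ) n).eval r := by
  have hE : ContDiff ℝ n fun x : ℝ =>
      (a * Real.sin θ * Real.cos x + a * Real.cos θ * Real.sin x) ^ (n + 1) := by
    fun_prop
  rw [hu.iteratedDeriv_eq h, iteratedDeriv_fun_mul (by fun_prop)
    (analyticAt_inv_sinc_zero.fun_pow _).contDiffAt, nodalDerivPoly, Polynomial.eval_finsetSum]
  refine Finset.sum_congr rfl fun k hk => ?_
  have hk' : (k : WithTop ℕ∞) ≤ n := by
    exact_mod_cast Nat.lt_succ_iff.1 (Finset.mem_range.1 hk)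
  have := congrFun (iteratedDeriv_comp_const_mul (hE.of_le hk') r) 0
  simp only [mul_zero] at this
  rw [this]
  simp
  ring

theorem nodalDerivPoly_coeff (α β : ℝ) (n k : ℕ) (hk : k ≤ n) :
    (nodalDerivPoly α β n).coeff k = n.choose k *
      iteratedDeriv k (fun x => (α * Real.cos x + β * Real.sin x) ^ (n + 1)) 0 *
      iteratedDeriv (n - k) (fun y => (Real.sinc y)⁻¹ ^ (n + 1)) 0 := by
  simp only [nodalDerivPoly, Polynomial.finsetSum_coeff, Polynomial.coeff_C_mul_X_pow]
  rw [Finset.sum_ite_eq, if_pos (by simp; omega)]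

/-- The constant term contains an odd derivative at 0 of the even function (y / sin y)ⁿ⁺¹. -/
theorem nodalDerivPoly_coeff_zero_of_odd (α β : ℝ) {n : ℕ} (hn : ¬ Even n) :
    (nodalDerivPoly α β n).coeff 0 = 0 := by
  rw [nodalDerivPoly_coeff _ _ _ _ n.zero_le, Nat.sub_zero,
    iteratedDeriv_inv_sinc_pow_odd _ _ (Nat.not_even_iff_odd.1 hn), mul_zero]

/-- Columns are counted from 0, so n corresponds to the derivative of order n + 1. For odd n, the
binomial coefficient n and the factor n + 1 from differentiating the power form the prefactor of
c_{n+1}. -/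
theorem nodalDerivPoly_lowest_coeff (α β : ℝ) (n : ℕ) :
    (nodalDerivPoly α β n).coeff (if Even n then 0 else 1) =
      lagrangeCoeff (n + 1) * (if Even n then α ^ (n + 1) else α ^ n * β) := by
  unfold lagrangeCoeff
  by_cases hn : Even n
  · rw [if_pos hn, if_pos hn, if_pos hn.add_one, nodalDerivPoly_coeff _ _ _ _ n.zero_le]
    simp
    ring
  · have hodd := Nat.not_even_iff_odd.1 hn
    rw [if_neg hn, if_neg hn, if_neg (by simpa [Nat.even_add_one] using hn),
      nodalDerivPoly_coeff _ _ _ _ hodd.pos]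
    have hd : deriv (fun x => (α * Real.cos x + β * Real.sin x) ^ (n + 1)) 0 =
        (n + 1) * α ^ n * β := by
      have := (((Real.hasDerivAt_cos 0).const_mul α).add
        ((Real.hasDerivAt_sin 0).const_mul β)).fun_pow (n + 1)
      simpa using this.deriv
    rw [iteratedDeriv_one, hd, show n + 1 - 2 = n - 1 by omega]
    push_cast
    simp
    ring

/-- The Wronskian of the nodal curves is a polynomial in `r` with the expected lowest term, as soon
as the expected coefficient does not vanish. -/
theorem wronskianHasLowestTerm_of_lowestCoeff_ne_zero {n₁ n₂ n₃ : ℕ} {φ ψ : ℝ}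
    {S : Finset (ℕ ×ₗ ℕ)} (h : lowestCoeff n₁ n₂ n₃ φ ψ S ≠ 0) :
    WronskianHasLowestTerm n₁ n₂ n₃ φ ψ S (S.card / 2) (lowestCoeff n₁ n₂ n₃ φ ψ S) := by
  -- Every column carries a factor α, so α = 0 at one node would produce a zero row.
  have hα : ∀ P ∈ S, alpha n₁ n₂ n₃ φ ψ P ≠ 0 := by
    intro P hP hP0
    refine h (mul_eq_zero_of_right _ ?_)
    obtain ⟨i, hi⟩ : P ∈ Set.range (S.orderEmbOfFin rfl) := by simpa using hP
    refine Matrix.det_eq_zero_of_row_eq_zero i fun j => ?_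
    simp only [Matrix.of_apply, hi, hP0]
    split_ifs with hj
    · simp
    · have : (j : ℕ) ≠ 0 := fun h0 => hj (by simp [h0])
      simp [this]
  refine ⟨fun r => ?_, ?_⟩
  · have : ∀ P, ∃ u, P ∈ S →
        IsNodalFunction (amplitude n₁ n₂ n₃ φ ψ P) (phase n₁ n₂ n₃ ψ P) r u := by
      intro P
      by_cases hP : P ∈ S
      · obtain ⟨u, hu⟩ := exists_isNodalFunction (hα P hP) r
        exact ⟨u, fun _ => hu⟩
      · exact ⟨0, fun h => absurd h hP⟩
    choose u hu using this
    exact ⟨u, hu⟩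
  · set M : Matrix (Fin S.card) (Fin S.card) (Polynomial ℝ) := Matrix.of fun i j =>
      nodalDerivPoly (alpha n₁ n₂ n₃ φ ψ (S.orderEmbOfFin rfl i))
        (beta n₁ n₂ n₃ φ ψ (S.orderEmbOfFin rfl i)) j with hM
    obtain ⟨h1, h2⟩ := coeff_det_of_coeff_eq_zero M (fun j => if Even (j : ℕ) then 0 else 1) (by
      intro i j k hk
      split_ifs at hk with hj
      · omega
      · obtain rfl : k = 0 := by omega
        exact nodalDerivPoly_coeff_zero_of_odd _ _ hj)
    rw [sum_ite_even] at h1 h2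
    refine ⟨M.det, fun r u hu => ?_, h1, ?_⟩
    · rw [wronskian, ← Polynomial.coe_evalRingHom, RingHom.map_det]
      congr 1
      ext1 i j
      have hi := S.orderEmbOfFin_mem rfl i
      exact (hu _ hi).iteratedDeriv_eq_eval (hα _ hi) j
    · rw [h2, lowestCoeff, prod_Icc_one_eq_prod_fin, ← Matrix.det_mul_row]
      congr 1
      ext1 i j
      exact nodalDerivPoly_lowest_coeff _ _ _

/-! ### Factorization of a determinant with paired rows. -/

open scoped Kronecker in
/-- The determinant of the matrix whose rows come in pairs `(p, ±)` and whose columns come in pairs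
`(A ^ i, ± A ^ i * b)`, up to a factor for each row. -/
theorem det_paired_rows {q : ℕ} (A b : Fin q → ℝ) (a : Fin 2 × Fin q → ℝ) :
    (Matrix.of fun x y : Fin 2 × Fin q => a x * (A x.2 ^ (y.2 : ℕ) *
      (if x.1 = 0 then b x.2 else -b x.2) ^ (y.1 : ℕ))).det =
    (∏ x, a x) * ((∏ p, (-2 * b p)) * (Matrix.vandermonde A).det ^ 2) := by
  refine (Matrix.det_mul_column a (Matrix.of fun x y : Fin 2 × Fin q => A x.2 ^ (y.2 : ℕ) *
      (if x.1 = 0 then b x.2 else -b x.2) ^ (y.1 : ℕ))).trans ?_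
  congr 1
  -- The 2 × 2 blocks act on the sign index and have determinant -2b; the Kronecker factor repeats
  -- the Vandermonde matrix twice, whence the square.
  have hM : (Matrix.of fun x y : Fin 2 × Fin q => A x.2 ^ (y.2 : ℕ) *
      (if x.1 = 0 then b x.2 else -b x.2) ^ (y.1 : ℕ)) =
      Matrix.blockDiagonal (fun p => !![1, b p; 1, -b p]) *
        ((1 : Matrix (Fin 2) (Fin 2) ℝ) ⊗ₖ Matrix.vandermonde A) := by
    ext ⟨s, p⟩ ⟨t, i⟩
    simp only [Matrix.mul_apply, Fintype.sum_prod_type, Matrix.blockDiagonal_apply,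
      Matrix.kroneckerMap_apply, Matrix.one_apply, Matrix.vandermonde_apply, Matrix.of_apply,
      ite_mul, zero_mul, mul_ite, mul_zero, one_mul, Fin.sum_univ_two]
    fin_cases s <;> fin_cases t <;> simp [mul_comm]
  rw [hM, Matrix.det_mul, Matrix.det_blockDiagonal, Matrix.det_kronecker]
  simp only [Matrix.det_one, one_pow, one_mul, Fintype.card_fin]
  congr 1
  refine Finset.prod_congr rfl fun p _ => ?_
  rw [Matrix.det_fin_two_of]
  ring

/-- Each unordered pair is counted twice. A product over ordered pairs does not depend on the
numbering of the representatives. -/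
theorem sq_det_vandermonde_eq_prod_abs {q : ℕ} (A : Fin q → ℝ) :
    (Matrix.vandermonde A).det ^ 2 = ∏ i, ∏ j, if i = j then 1 else |A i - A j| := by
  have h : ∀ i, (∏ j, if i = j then 1 else |A i - A j|) = ∏ j ∈ {i}ᶜ, |A i - A j| := by
    intro i
    rw [Finset.prod_ite, Finset.prod_const_one, one_mul]
    refine Finset.prod_congr ?_ fun _ _ => rfl
    ext j
    simp [eq_comm]
  simp only [h]
  rw [← Finset.prod_prod_Ioi_mul_eq_prod_prod_off_diag fun i j => |A j - A i|, ← sq_abs,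
    Matrix.det_vandermonde, Finset.abs_prod, sq, ← Finset.prod_mul_distrib]
  refine Finset.prod_congr rfl fun i _ => ?_
  rw [Finset.abs_prod, ← Finset.prod_mul_distrib]
  refine Finset.prod_congr rfl fun j _ => ?_
  rw [abs_sub_comm (A i) (A j)]

/-- The absolute value of the determinant with rows `(α, α β, α³, α³ β, …)` when the rows come in
pairs `P`, `τ P` with the same value of `α²` and opposite values of `β`. -/
theorem abs_det_of_pairing {ι : Type*} [LinearOrder ι] {S T : Finset ι} {τ : ι → ι} {α β : ι → ℝ}
    (hTS : T ⊆ S) (hτS : ∀ P ∈ T, τ P ∈ S) (hτT : ∀ P ∈ T, τ P ∉ T) (hinj : Set.InjOn τ T)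
    (hcover : ∀ P ∈ S, P ∉ T → ∃ Q ∈ T, τ Q = P)
    (hα : ∀ P ∈ T, α (τ P) ^ 2 = α P ^ 2) (hβ : ∀ P ∈ T, β (τ P) = -β P) :
    |(Matrix.of fun i j : Fin S.card =>
      if Even (j : ℕ) then α (S.orderEmbOfFin rfl i) ^ ((j : ℕ) + 1)
      else α (S.orderEmbOfFin rfl i) ^ (j : ℕ) * β (S.orderEmbOfFin rfl i)).det| =
    (∏ P ∈ T, 2 * (α P ^ 2 * |β P|)) *
      ∏ P ∈ T, ∏ Q ∈ T, if P = Q then 1 else |α P ^ 2 - α Q ^ 2| := by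
  set e : Fin T.card ≃ T := (T.orderIsoOfFin rfl).toEquiv
  have hmem : ∀ x : Fin 2 × Fin T.card,
      (if x.1 = 0 then ((e x.2 : T) : ι) else τ (e x.2)) ∈ S := by
    intro x
    split_ifs
    · exact hTS (e x.2).2
    · exact hτS _ (e x.2).2
  set f : Fin 2 × Fin T.card → S := fun x => ⟨_, hmem x⟩ with hf
  have hbij : Function.Bijective f := by
    constructor
    · rintro ⟨s, p⟩ ⟨s', p'⟩ h
      have h' := congrArg Subtype.val h
      simp only [hf] at h'
      split_ifs at h' with h0 h1 h1
      · rw [h0, h1, e.injective (Subtype.ext h')]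
      · exact absurd (h' ▸ (e p).2) (hτT _ (e p').2)
      · exact absurd (h' ▸ (e p').2) (hτT _ (e p).2)
      · have h2 := e.injective (Subtype.ext (hinj (e p).2 (e p').2 h'))
        rw [h2, Fin.eq_one_of_ne_zero s h0, Fin.eq_one_of_ne_zero s' h1]
    · rintro ⟨P, hP⟩
      by_cases hPT : P ∈ T
      · exact ⟨(0, e.symm ⟨P, hPT⟩), by simp [hf]⟩
      · obtain ⟨Q, hQ, rfl⟩ := hcover P hP hPT
        exact ⟨(1, e.symm ⟨Q, hQ⟩), by simp [hf]⟩
  set rowEquiv : Fin 2 × Fin T.card ≃ Fin S.card :=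
    (Equiv.ofBijective f hbij).trans (S.orderIsoOfFin rfl).toEquiv.symm
  have hcard : T.card * 2 = S.card := by
    have := Fintype.card_congr rowEquiv
    simp only [Fintype.card_prod, Fintype.card_fin] at this
    omega
  -- Column t + 2i carries α^(2i+1) β^t, which explains the pairing of neighbouring columns.
  set colEquiv : Fin 2 × Fin T.card ≃ Fin S.card :=
    (Equiv.prodComm _ _).trans (finProdFinEquiv.trans (finCongr hcard))
  have hrow : ∀ x, S.orderEmbOfFin rfl (rowEquiv x) =
      if x.1 = 0 then ((e x.2 : T) : ι) else τ (e x.2) := by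
    intro x
    have : S.orderIsoOfFin rfl (rowEquiv x) = f x := by simp [rowEquiv]
    rw [← Finset.coe_orderIsoOfFin_apply, this]
  have hcol : ∀ y, (colEquiv y : ℕ) = y.1 + 2 * y.2 := fun y => by simp [colEquiv]
  have hsq : ∀ x : Fin 2 × Fin T.card, α (if x.1 = 0 then ((e x.2 : T) : ι) else τ (e x.2)) ^ 2 = α (e x.2) ^ 2 := by
    intro x
    split_ifs
    · rfl
    · exact hα _ (e x.2).2
  have hneg : ∀ x : Fin 2 × Fin T.card, β (if x.1 = 0 then ((e x.2 : T) : ι) else τ (e x.2)) =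
      if x.1 = 0 then β (e x.2) else -β (e x.2) := by
    intro x
    split_ifs
    · rfl
    · exact hβ _ (e x.2).2
  -- Rows and columns are permuted independently, which may change the sign but not the absolute
  -- value.
  rw [← Matrix.abs_det_submatrix_equiv_equiv rowEquiv colEquiv]
  have hM : ((Matrix.of fun i j : Fin S.card =>
      if Even (j : ℕ) then α (S.orderEmbOfFin rfl i) ^ ((j : ℕ) + 1)
      else α (S.orderEmbOfFin rfl i) ^ (j : ℕ) * β (S.orderEmbOfFin rfl i)).submatrix
        rowEquiv colEquiv) =
      Matrix.of fun x y : Fin 2 × Fin T.card =>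
        α (if x.1 = 0 then ((e x.2 : T) : ι) else τ (e x.2)) * ((α (e x.2) ^ 2) ^ (y.2 : ℕ) *
      (if x.1 = 0 then β (e x.2) else -β (e x.2)) ^ (y.1 : ℕ)) := by
    ext x ⟨t, i⟩
    simp only [Matrix.submatrix_apply, Matrix.of_apply, hrow, hcol]
    rw [← hsq x, ← hneg x]
    generalize (if x.1 = 0 then ((e x.2 : T) : ι) else τ (e x.2)) = P
    fin_cases t
    · simp
      ring
    · simp [parity_simps]
      ring
  rw [hM, det_paired_rows (fun p => α (e p) ^ 2) (fun p => β (e p))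
    (fun x => α (if x.1 = 0 then ((e x.2 : T) : ι) else τ (e x.2))), sq_det_vandermonde_eq_prod_abs, abs_mul, abs_mul,
    Finset.abs_prod, Finset.abs_prod, Fintype.prod_prod_type, Fin.prod_univ_two,
    ← Finset.prod_mul_distrib, ← mul_assoc, ← Finset.prod_mul_distrib, abs_of_nonneg]
  · rw [← Finset.prod_coe_sort T, ← Finset.prod_coe_sort T, ← e.prod_comp, ← e.prod_comp]
    congr 1
    · refine Finset.prod_congr rfl fun p _ => ?_
      have h1 : |α (e p)| * |α (τ (e p))| = α (e p) ^ 2 := by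
        rw [(sq_eq_sq_iff_abs_eq_abs _ _).1 (hα _ (e p).2), ← sq, sq_abs]
      simp only [if_true, one_ne_zero, if_false, abs_mul, h1]
      norm_num
      ring
    · refine Finset.prod_congr rfl fun p _ => ?_
      rw [← Finset.prod_coe_sort T, ← e.prod_comp]
      refine Finset.prod_congr rfl fun p' _ => ?_
      simp
  · exact Finset.prod_nonneg fun i _ => Finset.prod_nonneg fun j _ => by split_ifs <;> positivity

/-! ### Combinatorics of the nodes and their pairing. -/

theorem exists_eq_toLex (P : ℕ ×ₗ ℕ) : ∃ k l : ℕ, P = toLex (k, l) := ⟨(ofLex P).1, (ofLex P).2, rfl⟩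

theorem toLex_mem_nodes {n₁ n₂ k l : ℕ} :
    toLex (k, l) ∈ nodes n₁ n₂ ↔ 0 < k ∧ 0 < l ∧ n₂ * k + n₁ * l < 2 * n₁ * n₂ := by
  simp only [nodes, Finset.mem_filter, Finset.mem_map, Finset.mem_product, Finset.mem_range,
    Equiv.coe_toEmbedding, EmbeddingLike.apply_eq_iff_eq, exists_eq_right, ofLex_toLex,
    and_iff_right_iff_imp]
  rintro ⟨_, _, h⟩
  constructor
  · by_contra! hk
    nlinarith [Nat.mul_le_mul_left n₂ hk]
  · by_contra! hl
    nlinarith [Nat.mul_le_mul_left n₁ hl]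

/-- A set of representatives of the orbits of the involution `partner`. -/
def transversal (n₁ n₂ : ℕ) : Finset (ℕ ×ₗ ℕ) :=
  (nodes n₁ n₂).filter fun P =>
    (n₂ * (ofLex P).1 < n₁ * (ofLex P).2 ∧ 2 * (ofLex P).1 < n₁ ∧
      n₁ * (ofLex P).2 < n₁ * n₂ + n₂ * (ofLex P).1) ∨
    (n₁ * (ofLex P).2 < n₂ * (ofLex P).1 ∧ 2 * (ofLex P).2 < n₂ ∧
      n₂ * (ofLex P).1 < n₁ * n₂ + n₁ * (ofLex P).2)

/-- The node whose `α` and `β` agree up to sign with those of a given node in `transversal`. -/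
def partner (n₁ n₂ : ℕ) (P : ℕ ×ₗ ℕ) : ℕ ×ₗ ℕ :=
  if n₂ * (ofLex P).1 < n₁ * (ofLex P).2 then
    if n₂ * (ofLex P).1 + n₁ * (ofLex P).2 < n₁ * n₂ then toLex ((ofLex P).1, (ofLex P).2 + n₂)
    else toLex (n₁ - (ofLex P).1, (ofLex P).2)
  else
    if n₂ * (ofLex P).1 + n₁ * (ofLex P).2 < n₁ * n₂ then toLex ((ofLex P).1 + n₁, (ofLex P).2)
    else toLex ((ofLex P).1, n₂ - (ofLex P).2)

/-- The node inequality is redundant: in the first case n₂k + n₁l < n₁n₂ + 2n₂k < 2n₁n₂, and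
symmetrically in the second. -/
theorem toLex_mem_transversal {n₁ n₂ k l : ℕ} (h₁ : 0 < n₁) (h₂ : 0 < n₂) :
    toLex (k, l) ∈ transversal n₁ n₂ ↔ (0 < k ∧ 0 < l) ∧
      ((n₂ * k < n₁ * l ∧ 2 * k < n₁ ∧ n₁ * l < n₁ * n₂ + n₂ * k) ∨
      (n₁ * l < n₂ * k ∧ 2 * l < n₂ ∧ n₂ * k < n₁ * n₂ + n₁ * l)) := by
  simp only [transversal, Finset.mem_filter, toLex_mem_nodes, ofLex_toLex]
  constructor
  · rintro ⟨⟨a, b, _⟩, c⟩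
    exact ⟨⟨a, b⟩, c⟩
  · rintro ⟨⟨a, b⟩, c⟩
    refine ⟨⟨a, b, ?_⟩, c⟩
    rw [mul_assoc]
    rcases c with ⟨c1, c2, c3⟩ | ⟨c1, c2, c3⟩
    · have := Nat.mul_lt_mul_of_pos_left c2 h₂
      have e : n₂ * (2 * k) = 2 * (n₂ * k) := by ring
      have e' : n₂ * n₁ = n₁ * n₂ := mul_comm _ _
      omega
    · have := Nat.mul_lt_mul_of_pos_left c2 h₁
      have e : n₁ * (2 * l) = 2 * (n₁ * l) := by ring
      omega

/-- What the combinatorics of the nodes uses of a pair of coprime numbers, for the node `(k, l)`. -/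
theorem mul_ne_mul_of_lt {n₁ n₂ : ℕ} (h : n₁.Coprime n₂) {k : ℕ} (hk0 : 0 < k) (hk : k < n₁)
    (l : ℕ) : n₂ * k ≠ n₁ * l ∧ n₂ * k + n₁ * l ≠ n₁ * n₂ := by
  have key : ¬ n₁ ∣ n₂ * k := fun hd =>
    absurd (Nat.le_of_dvd hk0 (h.dvd_of_dvd_mul_left hd)) (by omega)
  refine ⟨fun e => key ⟨l, e⟩, fun e => key ?_⟩
  exact (Nat.dvd_add_left (Dvd.intro l rfl)).1 (e ▸ Dvd.intro n₂ rfl)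

section

variable {n₁ n₂ : ℕ}

theorem transversal_subset : transversal n₁ n₂ ⊆ nodes n₁ n₂ := Finset.filter_subset _ _

/-- The four ways in which a node of `transversal` is related to its partner. -/
theorem partner_cases (h₁ : 0 < n₁) (h₂ : 0 < n₂) (h : n₁.Coprime n₂) {k l : ℕ}
    (hP : toLex (k, l) ∈ transversal n₁ n₂) :
    (n₂ * k < n₁ * l ∧ n₂ * k + n₁ * l < n₁ * n₂ ∧ 2 * k < n₁ ∧
      partner n₁ n₂ (toLex (k, l)) = toLex (k, l + n₂)) ∨
    (n₂ * k < n₁ * l ∧ n₁ * n₂ < n₂ * k + n₁ * l ∧ 2 * k < n₁ ∧ n₁ * l < n₁ * n₂ + n₂ * k ∧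
      partner n₁ n₂ (toLex (k, l)) = toLex (n₁ - k, l)) ∨
    (n₁ * l < n₂ * k ∧ n₂ * k + n₁ * l < n₁ * n₂ ∧ 2 * l < n₂ ∧
      partner n₁ n₂ (toLex (k, l)) = toLex (k + n₁, l)) ∨
    (n₁ * l < n₂ * k ∧ n₁ * n₂ < n₂ * k + n₁ * l ∧ 2 * l < n₂ ∧ n₂ * k < n₁ * n₂ + n₁ * l ∧
      partner n₁ n₂ (toLex (k, l)) = toLex (k, n₂ - l)) := by
  obtain ⟨⟨hk, hl⟩, ⟨a, b, c⟩ | ⟨a, b, c⟩⟩ := (toLex_mem_transversal h₁ h₂).1 hP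
  · have := (mul_ne_mul_of_lt h hk (by omega : k < n₁) l).2
    by_cases hs : n₂ * k + n₁ * l < n₁ * n₂
    · exact Or.inl ⟨a, hs, b, by simp [partner, a, hs]⟩
    · exact Or.inr (Or.inl ⟨a, by omega, b, c, by simp [partner, a, hs]⟩)
  · have := (mul_ne_mul_of_lt h.symm hl (by omega : l < n₂) k).2
    rw [mul_comm n₂ n₁] at this
    by_cases hs : n₂ * k + n₁ * l < n₁ * n₂
    · exact Or.inr (Or.inr (Or.inl ⟨a, hs, b, by simp [partner, a.not_gt, hs]⟩))
    · exact Or.inr (Or.inr (Or.inr ⟨a, by omega, b, c, by simp [partner, a.not_gt, hs]⟩))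

theorem two_mul_mul_lt (h₂ : 0 < n₂) {k : ℕ} : 2 * (n₂ * k) < n₁ * n₂ ↔ 2 * k < n₁ := by
  rw [← mul_assoc, mul_comm 2, mul_assoc, mul_comm n₁, Nat.mul_lt_mul_left h₂]

theorem partner_mem_nodes (h₁ : 0 < n₁) (h₂ : 0 < n₂) (h : n₁.Coprime n₂) {P : ℕ ×ₗ ℕ}
    (hP : P ∈ transversal n₁ n₂) :
    partner n₁ n₂ P ∈ nodes n₁ n₂ ∧ partner n₁ n₂ P ∉ transversal n₁ n₂ := by
  obtain ⟨k, l, rfl⟩ := exists_eq_toLex P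
  have hpos := ((toLex_mem_transversal h₁ h₂).1 hP).1
  -- With n₂k, n₁l and n₁n₂ as atoms, all conditions become linear.
  have e1 : n₂ * (n₁ - k) = n₁ * n₂ - n₂ * k := by rw [Nat.mul_sub, mul_comm n₁]
  have e2 : n₁ * (n₂ - l) = n₁ * n₂ - n₁ * l := by rw [Nat.mul_sub]
  have e3 : n₂ * (k + n₁) = n₁ * n₂ + n₂ * k := by ring
  have e4 : n₁ * (l + n₂) = n₁ * n₂ + n₁ * l := by ring
  have i1 : 2 * k < n₁ → 2 * (n₂ * k) < n₁ * n₂ := (two_mul_mul_lt h₂).2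
  have i2 : 2 * l < n₂ → 2 * (n₁ * l) < n₁ * n₂ := by
    rw [mul_comm n₁ n₂]; exact (two_mul_mul_lt h₁).2
  rcases partner_cases h₁ h₂ h hP with ⟨a, b, c, e⟩ | ⟨a, b, c, d, e⟩ | ⟨a, b, c, e⟩ |
    ⟨a, b, c, d, e⟩ <;>
  · rw [e, toLex_mem_nodes, toLex_mem_transversal h₁ h₂, mul_assoc 2]
    simp only [e1, e2, e3, e4]
    omega

theorem partner_injOn (h₁ : 0 < n₁) (h₂ : 0 < n₂) (h : n₁.Coprime n₂) :
    Set.InjOn (partner n₁ n₂) (transversal n₁ n₂) := by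
  intro P hP Q hQ hPQ
  obtain ⟨k, l, rfl⟩ := exists_eq_toLex P
  obtain ⟨k', l', rfl⟩ := exists_eq_toLex Q
  have e1 : n₂ * (n₁ - k) = n₁ * n₂ - n₂ * k := by rw [Nat.mul_sub, mul_comm n₁]
  have e2 : n₁ * (n₂ - l) = n₁ * n₂ - n₁ * l := by rw [Nat.mul_sub]
  have e3 : n₂ * (k + n₁) = n₁ * n₂ + n₂ * k := by ring
  have e4 : n₁ * (l + n₂) = n₁ * n₂ + n₁ * l := by ring
  have f1 : n₂ * (n₁ - k') = n₁ * n₂ - n₂ * k' := by rw [Nat.mul_sub, mul_comm n₁]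
  have f2 : n₁ * (n₂ - l') = n₁ * n₂ - n₁ * l' := by rw [Nat.mul_sub]
  have f3 : n₂ * (k' + n₁) = n₁ * n₂ + n₂ * k' := by ring
  have f4 : n₁ * (l' + n₂) = n₁ * n₂ + n₁ * l' := by ring
  have i1 : 2 * k < n₁ → 2 * (n₂ * k) < n₁ * n₂ := (two_mul_mul_lt h₂).2
  have i2 : 2 * l < n₂ → 2 * (n₁ * l) < n₁ * n₂ := by
    rw [mul_comm n₁ n₂]; exact (two_mul_mul_lt h₁).2
  have j1 : 2 * k' < n₁ → 2 * (n₂ * k') < n₁ * n₂ := (two_mul_mul_lt h₂).2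
  have j2 : 2 * l' < n₂ → 2 * (n₁ * l') < n₁ * n₂ := by
    rw [mul_comm n₁ n₂]; exact (two_mul_mul_lt h₁).2
  have key : ∀ {a b c d : ℕ}, toLex (a, b) = toLex (c, d) →
      a = c ∧ b = d ∧ n₂ * a = n₂ * c ∧ n₁ * b = n₁ * d := by
    intro a b c d habcd
    have := Prod.mk.inj (toLex.injective habcd)
    exact ⟨this.1, this.2, by rw [this.1], by rw [this.2]⟩
  have goal : k = k' ∧ l = l' := by
    rcases partner_cases h₁ h₂ h hP with ⟨a, b, c, e⟩ | ⟨a, b, c, d, e⟩ | ⟨a, b, c, e⟩ |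
      ⟨a, b, c, d, e⟩ <;>
    rcases partner_cases h₁ h₂ h hQ with ⟨a', b', c', e'⟩ | ⟨a', b', c', d', e'⟩ |
      ⟨a', b', c', e'⟩ | ⟨a', b', c', d', e'⟩ <;>
    · rw [e, e'] at hPQ
      have := key hPQ
      omega
  rw [goal.1, goal.2]

/-- A type I node outside the transversal either has 2k < n₁ and l too large, so n₂ is subtracted
from l, or has 2k > n₁, so k is reflected to n₁ - k. Type II is symmetric. Oddness rules out 2k = n₁
and 2l = n₂, coprimality the other boundary cases. -/
theorem exists_partner_eq (h₁ : 0 < n₁) (h₂ : 0 < n₂) (h : n₁.Coprime n₂) (ho₁ : Odd n₁)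
    (ho₂ : Odd n₂) {P : ℕ ×ₗ ℕ} (hP : P ∈ nodes n₁ n₂) (hPT : P ∉ transversal n₁ n₂) :
    ∃ Q ∈ transversal n₁ n₂, partner n₁ n₂ Q = P := by
  obtain ⟨k, l, rfl⟩ := exists_eq_toLex P
  obtain ⟨hk, hl, hlt⟩ := (toLex_mem_nodes).1 hP
  rw [toLex_mem_transversal h₁ h₂] at hPT
  have e1 : n₂ * (n₁ - k) = n₁ * n₂ - n₂ * k := by rw [Nat.mul_sub, mul_comm n₁]
  have e2 : n₁ * (n₂ - l) = n₁ * n₂ - n₁ * l := by rw [Nat.mul_sub]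
  have e3 : n₂ * (k - n₁) = n₂ * k - n₁ * n₂ := by rw [Nat.mul_sub, mul_comm n₁]
  have e4 : n₁ * (l - n₂) = n₁ * l - n₁ * n₂ := by rw [Nat.mul_sub]
  have i1 : 2 * (n₂ * k) < n₁ * n₂ ↔ 2 * k < n₁ := two_mul_mul_lt h₂
  have i2 : 2 * (n₁ * l) < n₁ * n₂ ↔ 2 * l < n₂ := by
    rw [mul_comm n₁ n₂]; exact two_mul_mul_lt h₁
  have j1 : n₂ * k < n₁ * n₂ ↔ k < n₁ := by rw [mul_comm n₁, Nat.mul_lt_mul_left h₂]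
  have j2 : n₁ * l < n₁ * n₂ ↔ l < n₂ := by rw [Nat.mul_lt_mul_left h₁]
  have j3 : n₁ * n₂ < n₂ * k ↔ n₁ < k := by rw [mul_comm n₁, Nat.mul_lt_mul_left h₂]
  have j4 : n₁ * n₂ < n₁ * l ↔ n₂ < l := by rw [Nat.mul_lt_mul_left h₁]
  obtain ⟨a₁, ha₁⟩ := ho₁
  obtain ⟨a₂, ha₂⟩ := ho₂
  rw [mul_assoc] at hlt
  rcases lt_trichotomy (n₂ * k) (n₁ * l) with hI | hE | hII
  · have hk1 : k < n₁ := by omega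
    have q1 := mul_ne_mul_of_lt h hk hk1 (l - n₂)
    by_cases hk2 : 2 * k < n₁
    · refine ⟨toLex (k, l - n₂), ?_, ?_⟩
      · rw [toLex_mem_transversal h₁ h₂]; omega
      · rw [partner, if_pos, if_pos] <;> simp only [ofLex_toLex] <;> [congr 2; skip; skip] <;> omega
    · have : 2 * (n₁ - k) < n₁ := by omega
      refine ⟨toLex (n₁ - k, l), ?_, ?_⟩
      · rw [toLex_mem_transversal h₁ h₂]; omega
      · rw [partner, if_pos, if_neg] <;> simp only [ofLex_toLex] <;> [congr 2; skip; skip] <;> omega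
  · have hk1 : k < n₁ := by omega
    exact absurd hE (mul_ne_mul_of_lt h hk hk1 l).1
  · have hl1 : l < n₂ := by omega
    have q1 := mul_ne_mul_of_lt h.symm hl hl1 (k - n₁)
    by_cases hl2 : 2 * l < n₂
    · refine ⟨toLex (k - n₁, l), ?_, ?_⟩
      · rw [toLex_mem_transversal h₁ h₂]; omega
      · rw [partner, if_neg, if_pos] <;> simp only [ofLex_toLex] <;> [congr 2; skip; skip] <;> omega
    · have : 2 * (n₂ - l) < n₂ := by omega
      refine ⟨toLex (k, n₂ - l), ?_, ?_⟩
      · rw [toLex_mem_transversal h₁ h₂]; omega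
      · rw [partner, if_neg, if_neg] <;> simp only [ofLex_toLex] <;> [congr 2; skip; skip] <;> omega

/-! ### The numbers α and β at partner nodes. -/

theorem isTypeI_toLex {k l : ℕ} : IsTypeI n₁ n₂ (toLex (k, l)) ↔ n₂ * k < n₁ * l := Iff.rfl

theorem amplitude_of_typeI {n₃ k l : ℕ} {φ ψ : ℝ} (h : n₂ * k < n₁ * l) :
    amplitude n₁ n₂ n₃ φ ψ (toLex (k, l)) = (-1) ^ (l + 1) *
      (Real.sin (Real.pi * (n₃ * k / n₁)) / Real.sin (Real.pi * (n₂ * k / n₁))) := by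
  simp [amplitude, isTypeI_toLex, h]

theorem amplitude_of_typeII {n₃ k l : ℕ} {φ ψ : ℝ} (h : n₁ * l < n₂ * k) :
    amplitude n₁ n₂ n₃ φ ψ (toLex (k, l)) = (-1) ^ (l + 1) *
      (Real.sin (2 * Real.pi * n₃ * (k / (2 * n₁) + φ + ψ)) /
        Real.sin (2 * Real.pi * n₂ * (k / (2 * n₁) + φ))) := by
  simp [amplitude, isTypeI_toLex, h.not_gt]

theorem phase_of_typeI {n₃ k l : ℕ} {ψ : ℝ} (h : n₂ * k < n₁ * l) :
    phase n₁ n₂ n₃ ψ (toLex (k, l)) = 2 * Real.pi * n₃ * (l / (2 * n₂) + ψ) := by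
  simp [phase, isTypeI_toLex, h]

theorem phase_of_typeII {n₃ k l : ℕ} {ψ : ℝ} (h : n₁ * l < n₂ * k) :
    phase n₁ n₂ n₃ ψ (toLex (k, l)) = 2 * Real.pi * n₃ * (l / (2 * n₂)) := by
  simp [phase, isTypeI_toLex, h.not_gt]

/-- The relation between `α`, `β` at a node and at its partner. -/
theorem alpha_beta_partner (h₁ : 0 < n₁) (h₂ : 0 < n₂) (h : n₁.Coprime n₂)
    (ho₂ : Odd n₂) {n₃ : ℕ} (he : Even n₃) (φ ψ : ℝ) {P : ℕ ×ₗ ℕ} (hP : P ∈ transversal n₁ n₂) :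
    alpha n₁ n₂ n₃ φ ψ (partner n₁ n₂ P) ^ 2 = alpha n₁ n₂ n₃ φ ψ P ^ 2 ∧
    beta n₁ n₂ n₃ φ ψ (partner n₁ n₂ P) = -beta n₁ n₂ n₃ φ ψ P := by
  obtain ⟨k, l, rfl⟩ := exists_eq_toLex P
  have e1 : n₂ * (n₁ - k) = n₁ * n₂ - n₂ * k := by rw [Nat.mul_sub, mul_comm n₁]
  have e2 : n₁ * (n₂ - l) = n₁ * n₂ - n₁ * l := by rw [Nat.mul_sub]
  have e3 : n₂ * (k + n₁) = n₁ * n₂ + n₂ * k := by ring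
  have e4 : n₁ * (l + n₂) = n₁ * n₂ + n₁ * l := by ring
  have r₁ : (n₁ : ℝ) ≠ 0 := by positivity
  have r₂ : (n₂ : ℝ) ≠ 0 := by positivity
  obtain ⟨m, rfl⟩ := he.two_dvd
  unfold alpha beta
  -- All four cases negate the amplitude. The first three keep the phase modulo 2π, so α and β both
  -- change sign; the last one negates the phase modulo 2π, so only β does.
  rcases partner_cases h₁ h₂ h hP with ⟨a, b, c, e⟩ | ⟨a, b, c, d, e⟩ | ⟨a, b, c, e⟩ |
    ⟨a, b, c, d, e⟩
  · rw [e, amplitude_of_typeI a, phase_of_typeI a, amplitude_of_typeI (by omega),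
      phase_of_typeI (by omega)]
    have e5 : 2 * Real.pi * ((2 * m : ℕ) : ℝ) * (((l + n₂ : ℕ) : ℝ) / (2 * n₂) + ψ) =
        2 * Real.pi * ((2 * m : ℕ) : ℝ) * (l / (2 * n₂) + ψ) + m * (2 * Real.pi) := by
      push_cast; field_simp; ring
    rw [e5, Real.sin_add_nat_mul_two_pi, Real.cos_add_nat_mul_two_pi,
      show l + n₂ + 1 = (l + 1) + n₂ by ring, pow_add _ _ n₂, ho₂.neg_one_pow]
    constructor <;> ring
  · have hk : k ≤ n₁ := by omega
    rw [e, amplitude_of_typeI a, phase_of_typeI a, amplitude_of_typeI (by omega),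
      phase_of_typeI (by omega)]
    have e5 : Real.pi * (((2 * m : ℕ) : ℝ) * ((n₁ - k : ℕ) : ℝ) / n₁) =
        m * (2 * Real.pi) - Real.pi * (((2 * m : ℕ) : ℝ) * k / n₁) := by
      push_cast [Nat.cast_sub hk]; field_simp
    have e6 : Real.pi * (n₂ * ((n₁ - k : ℕ) : ℝ) / n₁) =
        n₂ * Real.pi - Real.pi * (n₂ * k / n₁) := by
      push_cast [Nat.cast_sub hk]; field_simp
    rw [e5, e6, Real.sin_nat_mul_two_pi_sub, Real.sin_nat_mul_pi_sub, ho₂.neg_one_pow]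
    constructor <;> ring
  · rw [e, amplitude_of_typeII a, phase_of_typeII a, amplitude_of_typeII (by omega),
      phase_of_typeII (by omega)]
    have e5 : 2 * Real.pi * ((2 * m : ℕ) : ℝ) * (((k + n₁ : ℕ) : ℝ) / (2 * n₁) + φ + ψ) =
        2 * Real.pi * ((2 * m : ℕ) : ℝ) * (k / (2 * n₁) + φ + ψ) + m * (2 * Real.pi) := by
      push_cast; field_simp; ring
    have e6 : 2 * Real.pi * n₂ * (((k + n₁ : ℕ) : ℝ) / (2 * n₁) + φ) =
        2 * Real.pi * n₂ * (k / (2 * n₁) + φ) + n₂ * Real.pi := by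
      push_cast; field_simp; ring
    rw [e5, e6, Real.sin_add_nat_mul_two_pi, Real.sin_add_nat_mul_pi, ho₂.neg_one_pow]
    constructor <;> ring
  · have hl : l ≤ n₂ := by omega
    rw [e, amplitude_of_typeII a, phase_of_typeII a, amplitude_of_typeII (by omega),
      phase_of_typeII (by omega)]
    have e5 : 2 * Real.pi * ((2 * m : ℕ) : ℝ) * (((n₂ - l : ℕ) : ℝ) / (2 * n₂)) =
        m * (2 * Real.pi) - 2 * Real.pi * ((2 * m : ℕ) : ℝ) * (l / (2 * n₂)) := by
      push_cast [Nat.cast_sub hl]; field_simp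
    have e6 : ((-1 : ℝ)) ^ (l + 1) = -(-1) ^ (n₂ - l + 1) := by
      have : ((-1 : ℝ)) ^ (n₂ - l) * (-1) ^ l = -1 := by
        rw [← pow_add, Nat.sub_add_cancel hl, ho₂.neg_one_pow]
      have h' : ((-1 : ℝ)) ^ l * (-1) ^ l = 1 := by rw [← mul_pow]; simp
      rw [pow_succ, pow_succ]
      linear_combination (-1 : ℝ) ^ (n₂ - l) * h' - (-1 : ℝ) ^ l * this
    rw [e5, e6, Real.sin_nat_mul_two_pi_sub, Real.cos_nat_mul_two_pi_sub]
    constructor <;> ring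

end

/-! ### Galois conjugation of sines and cosines. -/

open IntermediateField in
/-- The Galois action `ζ ↦ ζ ^ a` on the cosines of the multiples of `2 π / N`. -/
theorem exists_ringHom_cos (N a : ℕ) (hN : N ≠ 0) (ha : a.Coprime N) :
    ∃ (K : Type) (_ : Field K) (ι σ : K →+* ℂ) (c : ℤ → K), ∀ j : ℤ,
      ι (c j) = (Real.cos (2 * Real.pi * j / N) : ℝ) ∧
      σ (c j) = (Real.cos (2 * Real.pi * (a * j) / N) : ℝ) := by
  set ζ := Complex.exp (2 * Real.pi * Complex.I / N) with hζ
  have hprim : IsPrimitiveRoot ζ N := Complex.isPrimitiveRoot_exp N hN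
  have hint : IsIntegral ℚ ζ := (hprim.isIntegral (Nat.pos_of_ne_zero hN)).tower_top
  -- The minimal polynomial of ζ is cyclotomic and so vanishes at the primitive root ζ ^ a as well.
  have hroot : ζ ^ a ∈ (minpoly ℚ ζ).aroots ℂ := by
    rw [Polynomial.mem_aroots, ← Polynomial.cyclotomic_eq_minpoly_rat hprim
      (Nat.pos_of_ne_zero hN)]
    refine ⟨Polynomial.cyclotomic_ne_zero _ _, ?_⟩
    have := (hprim.pow_of_coprime a ha).isRoot_cyclotomic (Nat.pos_of_ne_zero hN)
    rwa [Polynomial.IsRoot.def, ← Polynomial.map_cyclotomic N (algebraMap ℚ ℂ),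
      Polynomial.eval_map_algebraMap] at this
  set σ := (algHomAdjoinIntegralEquiv ℚ hint).symm ⟨_, hroot⟩
  have hσ : σ (AdjoinSimple.gen ℚ ζ) = ζ ^ a :=
    algHomAdjoinIntegralEquiv_symm_apply_gen ℚ hint ⟨_, hroot⟩
  have hpow : ∀ j : ℤ, (ζ ^ j + ζ ^ (-j)) / 2 = (Real.cos (2 * Real.pi * j / N) : ℝ) := by
    intro j
    rw [Complex.ofReal_cos, Complex.cos, hζ, ← Complex.exp_int_mul, ← Complex.exp_int_mul]
    push_cast
    congr 3 <;> ring
  refine ⟨ℚ⟮ζ⟯, inferInstance, algebraMap ℚ⟮ζ⟯ ℂ, σ.toRingHom,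
    fun j => (AdjoinSimple.gen ℚ ζ ^ j + AdjoinSimple.gen ℚ ζ ^ (-j)) / 2, fun j => ⟨?_, ?_⟩⟩
  · rw [map_div₀, map_add, map_zpow₀, map_zpow₀, AdjoinSimple.algebraMap_gen, map_ofNat, hpow]
  · change σ _ = _
    rw [map_div₀, map_add, map_zpow₀, map_zpow₀, hσ, map_ofNat]
    have := hpow (a * j)
    rw [zpow_mul, ← mul_neg, zpow_mul, zpow_natCast] at this
    rw [this]
    push_cast
    rfl

/-- The Galois action that fixes the roots of unity of odd order `n` and maps `i` to `-i`. -/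
theorem exists_ringHom_cos_sin (n : ℕ) (hn : Odd n) :
    ∃ (K : Type) (_ : Field K) (ι σ : K →+* ℂ) (c s : ℤ → K), ∀ j : ℤ,
      (ι (c j) = (Real.cos (2 * Real.pi * j / n) : ℝ) ∧
      ι (s j) = (Real.sin (2 * Real.pi * j / n) : ℝ)) ∧
      (σ (c j) = (Real.cos (2 * Real.pi * j / n) : ℝ) ∧
      σ (s j) = (-Real.sin (2 * Real.pi * j / n) : ℝ)) := by
  have hn0 : (n : ℝ) ≠ 0 := by exact_mod_cast hn.pos.ne'
  have h4 : Nat.Coprime 4 n := (Nat.coprime_two_left.2 hn).pow_left 2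
  -- The exponent a maps i to i³ = -i and fixes the n-th roots of unity.
  obtain ⟨a, ha4, han⟩ := Nat.chineseRemainder h4 3 1
  have ha : a.Coprime (4 * n) := by
    refine Nat.Coprime.mul_right ?_ ?_
    · rw [Nat.Coprime, ha4.gcd_eq]; rfl
    · rw [Nat.Coprime, han.gcd_eq]; simp
  obtain ⟨K, _, ι, σ, c, hc⟩ := exists_ringHom_cos (4 * n) a (by have := hn.pos; omega) ha
  obtain ⟨u, hu⟩ : ∃ u : ℤ, (a : ℤ) = 1 + n * u := by
    obtain ⟨u, hu⟩ := (Nat.modEq_iff_dvd.1 han.symm)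
    exact ⟨u, by push_cast at hu; linarith⟩
  obtain ⟨v, hv⟩ : ∃ v : ℤ, (a : ℤ) = 3 + 4 * v := by
    obtain ⟨v, hv⟩ := (Nat.modEq_iff_dvd.1 ha4.symm)
    exact ⟨v, by push_cast at hv; linarith⟩
  have hu' : (a : ℝ) = 1 + n * u := by exact_mod_cast hu
  have hv' : (a : ℝ) = 3 + 4 * v := by exact_mod_cast hv
  -- The sine is a cosine with a quarter turn: sin(2πj/n) = cos(2π(4j - n)/(4n)).
  refine ⟨K, _, ι, σ, fun j => c (4 * j), fun j => c (4 * j - n), fun j => ?_⟩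
  have hs : ∀ x, Real.cos (x - Real.pi / 2) = Real.sin x := Real.cos_sub_pi_div_two
  refine ⟨⟨?_, ?_⟩, ⟨?_, ?_⟩⟩
  · rw [(hc _).1]
    congr 2
    push_cast
    field_simp
  · rw [(hc _).1, ← hs]
    congr 2
    push_cast
    field_simp
    ring
  · rw [(hc _).2, ← Real.cos_add_int_mul_two_pi (2 * Real.pi * j / n) (u * j)]
    congr 2
    push_cast
    rw [hu']
    field_simp
  · rw [(hc _).2]
    congr 1
    have e : 2 * Real.pi * ((a : ℝ) * ((4 * j - n : ℤ) : ℝ)) / ((4 * n : ℕ) : ℝ) =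
        2 * Real.pi * j / n + Real.pi / 2 + ((u * j - v - 1 : ℤ) : ℝ) * (2 * Real.pi) := by
      have : (a : ℝ) * ((4 * j - n : ℤ) : ℝ) = 4 * j * (1 + n * u) - n * (3 + 4 * v) := by
        push_cast
        linear_combination (4 * j : ℝ) * hu' - (n : ℝ) * hv'
      rw [this]
      push_cast
      field_simp
      ring
    rw [e, Real.cos_add_int_mul_two_pi, Real.cos_add_pi_div_two]

/-- The Galois action that fixes the roots of unity of order `m` and squares those of odd
order `n`. -/
theorem exists_ringHom_cos_cos (m n : ℕ) (hm : 0 < m) (hn : Odd n) (hmn : m.Coprime n) :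
    ∃ (K : Type) (_ : Field K) (ι σ : K →+* ℂ) (c d : ℤ → K), ∀ j : ℤ,
      (ι (c j) = (Real.cos (2 * Real.pi * j / m) : ℝ) ∧
      ι (d j) = (Real.cos (2 * Real.pi * j / n) : ℝ)) ∧
      (σ (c j) = (Real.cos (2 * Real.pi * j / m) : ℝ) ∧
      σ (d j) = (Real.cos (2 * (2 * Real.pi * j / n)) : ℝ)) := by
  have hn0 : (n : ℝ) ≠ 0 := by exact_mod_cast hn.pos.ne'
  have hm0 : (m : ℝ) ≠ 0 := by exact_mod_cast hm.ne'
  obtain ⟨a, ham, han⟩ := Nat.chineseRemainder hmn 1 2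
  have ha : a.Coprime (m * n) := by
    refine Nat.Coprime.mul_right ?_ ?_
    · rw [Nat.Coprime, ham.gcd_eq]; simp
    · rw [Nat.Coprime, han.gcd_eq]; exact Nat.coprime_two_left.2 hn
  obtain ⟨K, _, ι, σ, c, hc⟩ := exists_ringHom_cos (m * n) a (mul_pos hm hn.pos).ne' ha
  obtain ⟨u, hu⟩ : ∃ u : ℤ, (a : ℤ) = 1 + m * u := by
    obtain ⟨u, hu⟩ := (Nat.modEq_iff_dvd.1 ham.symm)
    exact ⟨u, by push_cast at hu; linarith⟩
  obtain ⟨v, hv⟩ : ∃ v : ℤ, (a : ℤ) = 2 + n * v := by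
    obtain ⟨v, hv⟩ := (Nat.modEq_iff_dvd.1 han.symm)
    exact ⟨v, by push_cast at hv; linarith⟩
  have hu' : (a : ℝ) = 1 + m * u := by exact_mod_cast hu
  have hv' : (a : ℝ) = 2 + n * v := by exact_mod_cast hv
  refine ⟨K, _, ι, σ, fun j => c (n * j), fun j => c (m * j), fun j => ⟨⟨?_, ?_⟩, ⟨?_, ?_⟩⟩⟩
  · rw [(hc _).1]
    congr 2
    push_cast
    field_simp
  · rw [(hc _).1]
    congr 2
    push_cast
    field_simp
  · rw [(hc _).2, ← Real.cos_add_int_mul_two_pi (2 * Real.pi * j / m) (u * j)]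
    congr 2
    push_cast
    rw [hu']
    field_simp
  · rw [(hc _).2, ← Real.cos_add_int_mul_two_pi (2 * (2 * Real.pi * j / n)) (v * j)]
    congr 2
    push_cast
    rw [hv']
    field_simp

/-! ### Sines and cosines of multiples of 2π/n for odd n. -/

section

variable {n : ℕ} (hn : Odd n)
include hn

theorem cos_two_pi_mul_div_eq_iff {j j' : ℤ} :
    Real.cos (2 * Real.pi * j / n) = Real.cos (2 * Real.pi * j' / n) ↔
      (n : ℤ) ∣ j - j' ∨ (n : ℤ) ∣ j + j' := by
  have hn0 : (n : ℝ) ≠ 0 := by exact_mod_cast hn.pos.ne'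
  have hpi := Real.pi_ne_zero
  rw [Real.cos_eq_cos_iff]
  constructor
  · rintro ⟨k, h | h⟩
    · left
      refine ⟨-k, ?_⟩
      field_simp at h
      have h' : (j' : ℤ) = n * k + j := by exact_mod_cast h
      linarith
    · right
      refine ⟨k, ?_⟩
      field_simp at h
      have h' : (j' : ℤ) = n * k - j := by exact_mod_cast h
      linarith
  · rintro (⟨k, h⟩ | ⟨k, h⟩)
    · have h' : (j : ℝ) - j' = n * k := by exact_mod_cast h
      refine ⟨-k, Or.inl ?_⟩
      push_cast
      field_simp
      linarith
    · have h' : (j : ℝ) + j' = n * k := by exact_mod_cast h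
      refine ⟨k, Or.inr ?_⟩
      field_simp
      linarith

/-- For odd n the reflection x ↦ π - x never takes one multiple of 2π/n to another, so the sine,
unlike the cosine, separates residues. -/
theorem sin_two_pi_mul_div_injective {j j' : ℤ}
    (h : Real.sin (2 * Real.pi * j / n) = Real.sin (2 * Real.pi * j' / n)) : (n : ℤ) ∣ j - j' := by
  have hn0 : (n : ℝ) ≠ 0 := by exact_mod_cast hn.pos.ne'
  have hpi := Real.pi_ne_zero
  obtain ⟨k, h | h⟩ := Real.sin_eq_sin_iff.1 h
  · refine ⟨-k, ?_⟩
    field_simp at h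
    have h' : (j' : ℤ) = n * k + j := by
      have : (j' : ℝ) = n * k + j := by linarith
      exact_mod_cast this
    linarith
  · exfalso
    field_simp at h
    have h' : (2 * j' : ℤ) = n * (2 * k + 1) - 2 * j := by
      have : (2 * j' : ℝ) = n * (2 * k + 1) - 2 * j := by linarith
      exact_mod_cast this
    obtain ⟨m, rfl⟩ := hn
    push_cast at h'
    ring_nf at h'
    omega

theorem sin_two_pi_mul_div_ne (j : ℤ) :
    Real.sin (2 * Real.pi * j / n) ≠ 1 ∧ Real.sin (2 * Real.pi * j / n) ≠ -1 := by
  have hn0 : (n : ℝ) ≠ 0 := by exact_mod_cast hn.pos.ne'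
  have hpi := Real.pi_ne_zero
  have key : Real.cos (2 * Real.pi * j / n) ≠ 0 := by
    intro h
    obtain ⟨k, h⟩ := Real.cos_eq_zero_iff.1 h
    field_simp at h
    have h' : (4 * j : ℤ) = n * (2 * k + 1) := by
      have : (4 * j : ℝ) = n * (2 * k + 1) := by linarith
      exact_mod_cast this
    obtain ⟨m, rfl⟩ := hn
    push_cast at h'
    ring_nf at h'
    omega
  constructor <;> intro h <;> apply key <;> have := Real.sin_sq_add_cos_sq (2 * Real.pi * j / n) <;>
    rw [h] at this <;> simpa using this

theorem cos_two_pi_mul_div_ne_neg_one (j : ℤ) : Real.cos (2 * Real.pi * j / n) ≠ -1 := by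
  have hn0 : (n : ℝ) ≠ 0 := by exact_mod_cast hn.pos.ne'
  have hpi := Real.pi_ne_zero
  rw [← Real.cos_pi]
  intro h
  obtain ⟨k, h | h⟩ := Real.cos_eq_cos_iff.1 h
  all_goals
    field_simp at h
    have h' : (n : ℤ) = 2 * (n * k + j) ∨ (n : ℤ) = 2 * (n * k - j) := by
      first
      | left; have : (n : ℝ) = 2 * (n * k + j) := by linarith
        exact_mod_cast this
      | right; have : (n : ℝ) = 2 * (n * k - j) := by linarith
        exact_mod_cast this
    obtain ⟨m, rfl⟩ := hn
    push_cast at h'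
    omega

theorem cos_two_pi_mul_div_eq_one_iff {j : ℤ} :
    Real.cos (2 * Real.pi * j / n) = 1 ↔ (n : ℤ) ∣ j := by
  simpa using cos_two_pi_mul_div_eq_iff hn (j := j) (j' := 0)

end

/-! ### Separation of the values of α². -/

/-- If `p`, `q` are polynomials in cosines of multiples of `2 π / n`, the relation
`p (1 + sin) = q (1 + sin)` splits. -/
theorem eq_of_mul_one_add_sin_eq {n : ℕ} (hn : Odd n) {b d : ℤ} {p q : ℝ}
    (hp : p ∈ Subring.closure (Set.range fun j : ℤ => Real.cos (2 * Real.pi * j / n)))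
    (hq : q ∈ Subring.closure (Set.range fun j : ℤ => Real.cos (2 * Real.pi * j / n)))
    (h : p * (1 + Real.sin (2 * Real.pi * b / n)) = q * (1 + Real.sin (2 * Real.pi * d / n))) :
    p = q := by
  obtain ⟨K, _, ι, σ, c, s, hcs⟩ := exists_ringHom_cos_sin n hn
  have key : ∀ p ∈ Subring.closure (Set.range fun j : ℤ => Real.cos (2 * Real.pi * j / n)),
      ∃ x : K, ι x = (p : ℝ) ∧ σ x = (p : ℝ) := by
    intro p hp
    induction hp using Subring.closure_induction with
    | mem p hp =>
      obtain ⟨j, rfl⟩ := hp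
      exact ⟨c j, (hcs j).1.1, (hcs j).2.1⟩
    | zero => exact ⟨0, by simp, by simp⟩
    | one => exact ⟨1, by simp, by simp⟩
    | add p q _ _ hp hq =>
      obtain ⟨x, hx, hx'⟩ := hp
      obtain ⟨y, hy, hy'⟩ := hq
      exact ⟨x + y, by simp [hx, hy], by simp [hx', hy']⟩
    | neg p _ hp =>
      obtain ⟨x, hx, hx'⟩ := hp
      exact ⟨-x, by simp [hx], by simp [hx']⟩
    | mul p q _ _ hp hq =>
      obtain ⟨x, hx, hx'⟩ := hp
      obtain ⟨y, hy, hy'⟩ := hq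
      exact ⟨x * y, by simp [hx, hy], by simp [hx', hy']⟩
  obtain ⟨x, hx, hx'⟩ := key p hp
  obtain ⟨y, hy, hy'⟩ := key q hq
  -- The real relation is pulled back to `K` along the injective `ι` and pushed forward by `σ`.
  -- Adding the original and the conjugate relation gives 2p = 2q.
  have hK : x * (1 + s b) = y * (1 + s d) := by
    apply ι.injective
    simp only [map_mul, map_add, map_one, hx, hy, (hcs b).1.2, (hcs d).1.2]
    exact_mod_cast h
  have hσ := congrArg σ hK
  simp only [map_mul, map_add, map_one, hx', hy', (hcs b).2.2, (hcs d).2.2] at hσ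
  have hσ' : p * (1 + -Real.sin (2 * Real.pi * b / n)) =
      q * (1 + -Real.sin (2 * Real.pi * d / n)) := by exact_mod_cast hσ
  linarith

section

variable {n₁ n₂ : ℕ} (ho₁ : Odd n₁) (ho₂ : Odd n₂)
include ho₁ ho₂

theorem cos_left_mem (j : ℤ) : Real.cos (2 * Real.pi * j / n₁) ∈
    Subring.closure (Set.range fun j : ℤ => Real.cos (2 * Real.pi * j / (n₁ * n₂ : ℕ))) := by
  have r₁ : (n₁ : ℝ) ≠ 0 := by exact_mod_cast ho₁.pos.ne'
  have r₂ : (n₂ : ℝ) ≠ 0 := by exact_mod_cast ho₂.pos.ne'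
  refine Subring.subset_closure ⟨n₂ * j, ?_⟩
  push_cast
  congr 1
  field_simp

theorem sin_left_eq (j : ℤ) : Real.sin (2 * Real.pi * j / n₁) =
    Real.sin (2 * Real.pi * (n₂ * j : ℤ) / (n₁ * n₂ : ℕ)) := by
  have r₁ : (n₁ : ℝ) ≠ 0 := by exact_mod_cast ho₁.pos.ne'
  have r₂ : (n₂ : ℝ) ≠ 0 := by exact_mod_cast ho₂.pos.ne'
  push_cast
  congr 1
  field_simp

theorem eq_of_typeI_eq {k l k' l' : ℤ}
    (h : (1 + Real.cos (2 * Real.pi * k / n₁)) * (1 + Real.sin (2 * Real.pi * l / n₂)) =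
      (1 + Real.cos (2 * Real.pi * k' / n₁)) * (1 + Real.sin (2 * Real.pi * l' / n₂))) :
    Real.cos (2 * Real.pi * k / n₁) = Real.cos (2 * Real.pi * k' / n₁) ∧ (n₂ : ℤ) ∣ l - l' := by
  have hc := fun j => add_mem (one_mem _) (cos_left_mem ho₁ ho₂ j)
  have h0 := h
  rw [sin_left_eq ho₂ ho₁ l, sin_left_eq ho₂ ho₁ l', mul_comm n₂ n₁] at h0
  have h1 := eq_of_mul_one_add_sin_eq (ho₁.mul ho₂) (hc k) (hc k') h0
  have h2 : 1 + Real.cos (2 * Real.pi * k / n₁) ≠ 0 := fun h =>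
    cos_two_pi_mul_div_ne_neg_one ho₁ k (by linarith)
  rw [← h1] at h
  exact ⟨by linarith, sin_two_pi_mul_div_injective ho₂ (by linarith [mul_left_cancel₀ h2 h])⟩

/-- Once denominators are cleared, splitting off the sines shows that the cosine parts agree.
Cancelling them gives equal sines, hence k ≡ k' mod n₁, and the cosines in l remain. -/
theorem eq_of_typeII_eq {k l k' l' : ℤ} (hk : ¬ (n₁ : ℤ) ∣ k) (hk' : ¬ (n₁ : ℤ) ∣ k')
    (hl : ¬ (n₂ : ℤ) ∣ l) (hl' : ¬ (n₂ : ℤ) ∣ l')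
    (h : (1 + Real.sin (2 * Real.pi * (2 * k : ℤ) / n₁)) /
        (1 - Real.cos (2 * Real.pi * k / n₁)) * (1 - Real.cos (2 * Real.pi * l / n₂)) =
      (1 + Real.sin (2 * Real.pi * (2 * k' : ℤ) / n₁)) /
        (1 - Real.cos (2 * Real.pi * k' / n₁)) * (1 - Real.cos (2 * Real.pi * l' / n₂))) :
    (n₁ : ℤ) ∣ k - k' ∧ Real.cos (2 * Real.pi * l / n₂) = Real.cos (2 * Real.pi * l' / n₂) := by
  have hc := fun j => sub_mem (one_mem _) (cos_left_mem ho₁ ho₂ j)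
  have hc' : ∀ j : ℤ, 1 - Real.cos (2 * Real.pi * j / n₂) ∈ Subring.closure
      (Set.range fun j : ℤ => Real.cos (2 * Real.pi * j / (n₁ * n₂ : ℕ))) := by
    intro j
    have := cos_left_mem ho₂ ho₁ j
    rw [mul_comm n₂ n₁] at this
    exact sub_mem (one_mem _) this
  have hne₁ : ∀ {j : ℤ}, ¬ (n₁ : ℤ) ∣ j → 1 - Real.cos (2 * Real.pi * j / n₁) ≠ 0 :=
    fun hj h => hj ((cos_two_pi_mul_div_eq_one_iff ho₁).1 (by linarith))
  have hne₂ : ∀ {j : ℤ}, ¬ (n₂ : ℤ) ∣ j → 1 - Real.cos (2 * Real.pi * j / n₂) ≠ 0 :=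
    fun hj h => hj ((cos_two_pi_mul_div_eq_one_iff ho₂).1 (by linarith))
  have a1 := hne₁ hk
  have a2 := hne₁ hk'
  have a3 := hne₂ hl
  have a4 := hne₂ hl'
  have h0 : ((1 - Real.cos (2 * Real.pi * k' / n₁)) * (1 - Real.cos (2 * Real.pi * l / n₂))) *
      (1 + Real.sin (2 * Real.pi * (2 * k : ℤ) / n₁)) =
      ((1 - Real.cos (2 * Real.pi * k / n₁)) * (1 - Real.cos (2 * Real.pi * l' / n₂))) *
      (1 + Real.sin (2 * Real.pi * (2 * k' : ℤ) / n₁)) := by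
    rw [div_mul_eq_mul_div, div_mul_eq_mul_div, div_eq_div_iff a1 a2] at h
    linear_combination h
  have h1 := h0
  rw [sin_left_eq ho₁ ho₂ (2 * k), sin_left_eq ho₁ ho₂ (2 * k')] at h1
  have h2 := eq_of_mul_one_add_sin_eq (ho₁.mul ho₂) (mul_mem (hc k') (hc' l))
    (mul_mem (hc k) (hc' l')) h1
  rw [← h2] at h0
  have h3 := mul_left_cancel₀ (mul_ne_zero a2 a3) h0
  have h4 := sin_two_pi_mul_div_injective ho₁ (add_left_cancel h3)
  have h5 : (n₁ : ℤ) ∣ k - k' := by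
    rw [← mul_sub] at h4
    exact (Int.isCoprime_iff_gcd_eq_one.2 (by
      simpa [Int.gcd] using (Nat.coprime_two_right.2 ho₁))).dvd_of_dvd_mul_left h4
  refine ⟨h5, ?_⟩
  rw [(cos_two_pi_mul_div_eq_iff ho₁).2 (Or.inl h5)] at h2
  linarith [mul_left_cancel₀ a2 h2]

/-- Splitting off the sines would leave 2(1 + cos(2πk/n₁))(1 - cos(2πk'/n₁)) = 1 - cos(2πl'/n₂).
Squaring the n₂-th roots of unity fixes the left side, so cos(2πl'/n₂) = cos(4πl'/n₂) and n₂ divides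
l' or 3l'. -/
theorem typeI_ne_typeII (h : n₁.Coprime n₂) (h3 : n₂.Coprime 3) {k l k' l' : ℤ}
    (hk' : ¬ (n₁ : ℤ) ∣ k') (hl' : ¬ (n₂ : ℤ) ∣ l') :
    (1 + Real.cos (2 * Real.pi * k / n₁)) * (1 + Real.sin (2 * Real.pi * l / n₂)) ≠
      (1 + Real.sin (2 * Real.pi * (2 * k' : ℤ) / n₁)) /
        (1 - Real.cos (2 * Real.pi * k' / n₁)) * ((1 - Real.cos (2 * Real.pi * l' / n₂)) / 2) := by
  intro heq
  have hc := fun j => sub_mem (one_mem _) (cos_left_mem ho₁ ho₂ j)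
  have hc1 := fun j => add_mem (one_mem _) (cos_left_mem ho₁ ho₂ j)
  have hc' : ∀ j : ℤ, 1 - Real.cos (2 * Real.pi * j / n₂) ∈ Subring.closure
      (Set.range fun j : ℤ => Real.cos (2 * Real.pi * j / (n₁ * n₂ : ℕ))) := by
    intro j
    have := cos_left_mem ho₂ ho₁ j
    rw [mul_comm n₂ n₁] at this
    exact sub_mem (one_mem _) this
  have a1 : 1 - Real.cos (2 * Real.pi * k' / n₁) ≠ 0 :=
    fun h => hk' ((cos_two_pi_mul_div_eq_one_iff ho₁).1 (by linarith))
  have h0 : ((1 + 1) * ((1 + Real.cos (2 * Real.pi * k / n₁)) *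
      (1 - Real.cos (2 * Real.pi * k' / n₁)))) * (1 + Real.sin (2 * Real.pi * l / n₂)) =
      (1 - Real.cos (2 * Real.pi * l' / n₂)) *
      (1 + Real.sin (2 * Real.pi * (2 * k' : ℤ) / n₁)) := by
    rw [div_mul_eq_mul_div, eq_div_iff a1] at heq
    linear_combination 2 * heq
  rw [sin_left_eq ho₂ ho₁ l, mul_comm n₂ n₁, sin_left_eq ho₁ ho₂ (2 * k')] at h0
  have h1 := eq_of_mul_one_add_sin_eq (ho₁.mul ho₂)
    (mul_mem (add_mem (one_mem _) (one_mem _)) (mul_mem (hc1 k) (hc k'))) (hc' l') h0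
  obtain ⟨K, _, ι, σ, c, d, hcd⟩ := exists_ringHom_cos_cos n₁ n₂ ho₁.pos ho₂ h
  have hK : (1 + 1) * ((1 + c k) * (1 - c k')) = 1 - d l' := by
    apply ι.injective
    simp only [map_mul, map_add, map_sub, map_one, (hcd _).1.1, (hcd _).1.2]
    exact_mod_cast h1
  have hσ := congrArg σ hK
  simp only [map_mul, map_add, map_sub, map_one, (hcd _).2.1, (hcd _).2.2] at hσ
  have h2 : (1 + 1) * ((1 + Real.cos (2 * Real.pi * k / n₁)) *
      (1 - Real.cos (2 * Real.pi * k' / n₁))) = 1 - Real.cos (2 * (2 * Real.pi * l' / n₂)) := by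
    exact_mod_cast hσ
  have h4 : Real.cos (2 * Real.pi * l' / n₂) = Real.cos (2 * Real.pi * (2 * l' : ℤ) / n₂) := by
    have : 2 * Real.pi * ((2 * l' : ℤ) : ℝ) / n₂ = 2 * (2 * Real.pi * l' / n₂) := by
      push_cast; ring
    rw [this]
    linarith
  rcases (cos_two_pi_mul_div_eq_iff ho₂).1 h4 with hd | hd
  · exact hl' (by simpa [show l' - 2 * l' = -l' by ring] using hd)
  · rw [show l' + 2 * l' = 3 * l' by ring] at hd
    exact hl' ((Int.isCoprime_iff_gcd_eq_one.2 (by simpa [Int.gcd] using h3)).dvd_of_dvd_mul_left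
      hd)

end

/-! ### Values at φ = 0 and nonvanishing of D₀ on the regular nodes. -/

/-- The hypotheses on the frequencies and on the phase. -/
structure Admissible (n₁ n₂ n₃ : ℕ) (ψ : ℝ) : Prop where
  odd₁ : Odd n₁
  odd₂ : Odd n₂
  even₃ : Even n₃
  one_lt₂ : 1 < n₂
  coprime : n₁.Coprime n₂
  coprime_three : n₂.Coprime 3
  mod₁ : n₂ ≡ 1 [MOD n₁]
  mod₂ : n₃ ≡ 2 [MOD n₁]
  mod₃ : n₃ ≡ 2 [MOD n₂]
  hψ : 2 * Real.pi * n₃ * ψ = Real.pi / 4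

theorem exists_real_eq_of_modEq {a c n : ℕ} (h : a ≡ c [MOD n]) : ∃ t : ℤ, (a : ℝ) = c + n * t := by
  obtain ⟨t, ht⟩ := Nat.modEq_iff_dvd.1 h.symm
  refine ⟨t, ?_⟩
  have : (a : ℤ) = c + n * t := by linarith
  exact_mod_cast this

theorem neg_one_pow_sq (l : ℕ) : ((-1 : ℝ) ^ l) ^ 2 = 1 := by
  rw [← pow_mul, mul_comm, pow_mul]; simp

namespace Admissible

variable {n₁ n₂ n₃ : ℕ} {ψ : ℝ} (H : Admissible n₁ n₂ n₃ ψ)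
include H

theorem pos₁ : 0 < n₁ := H.odd₁.pos

theorem pos₂ : 0 < n₂ := H.odd₂.pos

theorem cast_ne₁ : (n₁ : ℝ) ≠ 0 := by exact_mod_cast H.pos₁.ne'

theorem cast_ne₂ : (n₂ : ℝ) ≠ 0 := by exact_mod_cast H.pos₂.ne'

theorem one_sub_cos_ne_zero {k : ℤ} (hk : ¬ (n₁ : ℤ) ∣ k) :
    1 - Real.cos (2 * Real.pi * k / n₁) ≠ 0 :=
  fun h => hk ((cos_two_pi_mul_div_eq_one_iff H.odd₁).1 (by linarith))

theorem sin_sq_denominator (k : ℕ) : Real.sin (Real.pi * (n₂ * k / n₁)) ^ 2 =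
    (1 - Real.cos (2 * Real.pi * (k : ℤ) / n₁)) / 2 := by
  have r₁ := H.cast_ne₁
  obtain ⟨t, ht⟩ := exists_real_eq_of_modEq H.mod₁
  have : 2 * (Real.pi * (n₂ * k / n₁)) =
      2 * Real.pi * (k : ℤ) / n₁ + (t * k : ℤ) * (2 * Real.pi) := by
    rw [ht]; push_cast; field_simp
  rw [Real.sin_sq_eq_half_sub, this, Real.cos_add_int_mul_two_pi]
  ring

/-- With θ = 2πk/n₁, the congruences modulo n₁ reduce the square to (1 - cos 2θ)/(1 - cos θ). -/
theorem amplitude_sq_typeI {k l : ℕ} (hI : n₂ * k < n₁ * l) (hk : ¬ (n₁ : ℤ) ∣ k) (φ : ℝ) :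
    amplitude n₁ n₂ n₃ φ ψ (toLex (k, l)) ^ 2 = 2 * (1 + Real.cos (2 * Real.pi * (k : ℤ) / n₁)) := by
  have r₁ := H.cast_ne₁
  obtain ⟨i, hi⟩ := exists_real_eq_of_modEq H.mod₂
  have e : 2 * (Real.pi * (n₃ * k / n₁)) =
      2 * (2 * Real.pi * (k : ℤ) / n₁) + (i * k : ℤ) * (2 * Real.pi) := by
    rw [hi]; push_cast; field_simp
  have hne := H.one_sub_cos_ne_zero hk
  rw [amplitude_of_typeI hI, mul_pow, neg_one_pow_sq, one_mul, div_pow, H.sin_sq_denominator,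
    Real.sin_sq_eq_half_sub, e, Real.cos_add_int_mul_two_pi, Real.cos_two_mul]
  field_simp
  ring

theorem amplitude_sq_typeII {k l : ℕ} (hII : n₁ * l < n₂ * k) :
    amplitude n₁ n₂ n₃ 0 ψ (toLex (k, l)) ^ 2 =
      (1 + Real.sin (2 * Real.pi * (2 * k : ℤ) / n₁)) /
        (1 - Real.cos (2 * Real.pi * (k : ℤ) / n₁)) := by
  have r₁ := H.cast_ne₁
  obtain ⟨i, hi⟩ := exists_real_eq_of_modEq H.mod₂
  -- Doubling turns 2πn₃ψ = π/4 into a quarter turn, which replaces the cosine by a sine.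
  have e : 2 * (2 * Real.pi * n₃ * (k / (2 * n₁) + 0 + ψ)) =
      2 * Real.pi * (2 * k : ℤ) / n₁ + Real.pi / 2 + (i * k : ℤ) * (2 * Real.pi) := by
    have : 2 * (2 * Real.pi * n₃ * (k / (2 * n₁) + 0 + ψ)) =
      2 * Real.pi * n₃ * k / n₁ + 2 * (2 * Real.pi * n₃ * ψ) := by
      field_simp; ring
    rw [this, H.hψ, hi]; push_cast; field_simp; ring
  have e' : 2 * Real.pi * n₂ * ((k : ℝ) / (2 * n₁) + 0) = Real.pi * (n₂ * k / n₁) := by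
    field_simp; ring
  rw [amplitude_of_typeII hII, mul_pow, neg_one_pow_sq, one_mul, div_pow, e',
    H.sin_sq_denominator, Real.sin_sq_eq_half_sub, e, Real.cos_add_int_mul_two_pi,
    Real.cos_add_pi_div_two, neg_div, sub_neg_eq_add, ← add_div,
    div_div_div_cancel_right₀ two_ne_zero]

theorem cos_two_mul_phase_typeI {k l : ℕ} (hI : n₂ * k < n₁ * l) :
    Real.cos (2 * phase n₁ n₂ n₃ ψ (toLex (k, l))) =
      -Real.sin (2 * Real.pi * (2 * l : ℤ) / n₂) := by
  have r₂ := H.cast_ne₂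
  obtain ⟨i, hi⟩ := exists_real_eq_of_modEq H.mod₃
  have e : 2 * (2 * Real.pi * n₃ * (l / (2 * n₂) + ψ)) =
      2 * Real.pi * (2 * l : ℤ) / n₂ + Real.pi / 2 + (i * l : ℤ) * (2 * Real.pi) := by
    have : 2 * (2 * Real.pi * n₃ * (l / (2 * n₂) + ψ)) =
      2 * Real.pi * n₃ * l / n₂ + 2 * (2 * Real.pi * n₃ * ψ) := by
      field_simp
    rw [this, H.hψ, hi]; push_cast; field_simp; ring
  rw [phase_of_typeI hI, e, Real.cos_add_int_mul_two_pi, Real.cos_add_pi_div_two]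

theorem cos_two_mul_phase_typeII {k l : ℕ} (hII : n₁ * l < n₂ * k) :
    Real.cos (2 * phase n₁ n₂ n₃ ψ (toLex (k, l))) =
      Real.cos (2 * Real.pi * (2 * l : ℤ) / n₂) := by
  have r₂ := H.cast_ne₂
  obtain ⟨i, hi⟩ := exists_real_eq_of_modEq H.mod₃
  have e : 2 * (2 * Real.pi * n₃ * ((l : ℝ) / (2 * n₂))) =
      2 * Real.pi * (2 * l : ℤ) / n₂ + (i * l : ℤ) * (2 * Real.pi) := by
    rw [hi]; push_cast; field_simp
  rw [phase_of_typeII hII, e, Real.cos_add_int_mul_two_pi]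

omit H in
theorem alpha_sq_eq (φ : ℝ) (P : ℕ ×ₗ ℕ) : alpha n₁ n₂ n₃ φ ψ P ^ 2 =
    amplitude n₁ n₂ n₃ φ ψ P ^ 2 * ((1 - Real.cos (2 * phase n₁ n₂ n₃ ψ P)) / 2) := by
  rw [alpha, mul_pow, Real.sin_sq_eq_half_sub]; ring

omit H in
theorem beta_sq_eq (φ : ℝ) (P : ℕ ×ₗ ℕ) : beta n₁ n₂ n₃ φ ψ P ^ 2 =
    amplitude n₁ n₂ n₃ φ ψ P ^ 2 * ((1 + Real.cos (2 * phase n₁ n₂ n₃ ψ P)) / 2) := by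
  rw [beta, mul_pow, Real.cos_sq]; ring

theorem alpha_sq_typeI {k l : ℕ} (hI : n₂ * k < n₁ * l) (hk : ¬ (n₁ : ℤ) ∣ k) (φ : ℝ) :
    alpha n₁ n₂ n₃ φ ψ (toLex (k, l)) ^ 2 = (1 + Real.cos (2 * Real.pi * (k : ℤ) / n₁)) *
      (1 + Real.sin (2 * Real.pi * (2 * l : ℤ) / n₂)) := by
  rw [alpha_sq_eq, H.amplitude_sq_typeI hI hk, H.cos_two_mul_phase_typeI hI]; ring

theorem alpha_sq_typeII {k l : ℕ} (hII : n₁ * l < n₂ * k) :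
    alpha n₁ n₂ n₃ 0 ψ (toLex (k, l)) ^ 2 = (1 + Real.sin (2 * Real.pi * (2 * k : ℤ) / n₁)) /
        (1 - Real.cos (2 * Real.pi * (k : ℤ) / n₁)) *
      ((1 - Real.cos (2 * Real.pi * (2 * l : ℤ) / n₂)) / 2) := by
  rw [alpha_sq_eq, H.amplitude_sq_typeII hII, H.cos_two_mul_phase_typeII hII]

/-- The combinatorial form of membership in `transversal` used below. -/
theorem transversal_cases {k l : ℕ} (hP : toLex (k, l) ∈ transversal n₁ n₂) (hk : k ≠ n₁) :
    ¬ (n₁ : ℤ) ∣ k ∧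
    ((n₂ * k < n₁ * l ∧ 0 < k ∧ 2 * k < n₁ ∧ n₁ * l < n₁ * n₂ + n₂ * k) ∨
    (n₁ * l < n₂ * k ∧ (0 < l ∧ 2 * l < n₂ ∧ ¬ (n₂ : ℤ) ∣ 2 * l) ∧
      n₂ * k < n₁ * n₂ + n₁ * l)) := by
  have hnode := toLex_mem_nodes.1 (transversal_subset hP)
  have hk2 : k < 2 * n₁ := by
    have : n₂ * k < n₂ * (2 * n₁) := by
      calc n₂ * k < 2 * n₁ * n₂ := by omega
        _ = _ := by ring
    exact lt_of_mul_lt_mul_left this n₂.zero_le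
  have hdvd : ¬ (n₁ : ℤ) ∣ k := by
    rw [Int.natCast_dvd_natCast]
    rintro ⟨c, rfl⟩
    have hc1 : c < 2 := by
      by_contra! hc
      nlinarith [Nat.mul_le_mul_left n₁ hc]
    interval_cases c <;> omega
  refine ⟨hdvd, ?_⟩
  obtain ⟨⟨h1, h2⟩, ⟨a, b, c⟩ | ⟨a, b, c⟩⟩ := (toLex_mem_transversal H.pos₁ H.pos₂).1 hP
  · exact Or.inl ⟨a, h1, b, c⟩
  · refine Or.inr ⟨a, ⟨h2, b, ?_⟩, c⟩
    have : ((2 * l : ℤ)) = ((2 * l : ℕ) : ℤ) := by push_cast; rfl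
    rw [this, Int.natCast_dvd_natCast]
    intro h
    have := Nat.le_of_dvd (by omega) h
    omega

theorem alpha_beta_ne_zero {P : ℕ ×ₗ ℕ} (hP : P ∈ transversal n₁ n₂) (hk : (ofLex P).1 ≠ n₁) :
    alpha n₁ n₂ n₃ 0 ψ P ≠ 0 ∧ beta n₁ n₂ n₃ 0 ψ P ≠ 0 := by
  obtain ⟨k, l, rfl⟩ := exists_eq_toLex P
  obtain ⟨hd, ⟨a, -⟩ | ⟨a, ⟨-, -, hl⟩, -⟩⟩ := H.transversal_cases hP hk
  all_goals rw [← pow_ne_zero_iff two_ne_zero, ← pow_ne_zero_iff (a := beta _ _ _ _ _ _) two_ne_zero,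
    alpha_sq_eq, beta_sq_eq]
  · have h1 : 1 + Real.cos (2 * Real.pi * (k : ℤ) / n₁) ≠ 0 := fun h =>
      cos_two_pi_mul_div_ne_neg_one H.odd₁ k (by linarith)
    have h2 := sin_two_pi_mul_div_ne H.odd₂ (2 * l)
    rw [H.amplitude_sq_typeI a hd, H.cos_two_mul_phase_typeI a]
    refine ⟨mul_ne_zero (mul_ne_zero two_ne_zero h1) fun h => h2.2 ?_,
      mul_ne_zero (mul_ne_zero two_ne_zero h1) fun h => h2.1 ?_⟩ <;> linarith
  · have h1 := H.one_sub_cos_ne_zero hd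
    have h2 : 1 + Real.sin (2 * Real.pi * (2 * k : ℤ) / n₁) ≠ 0 := fun h =>
      (sin_two_pi_mul_div_ne H.odd₁ (2 * k)).2 (by linarith)
    rw [H.amplitude_sq_typeII a, H.cos_two_mul_phase_typeII a]
    refine ⟨mul_ne_zero (div_ne_zero h2 h1) fun h => hl ?_,
      mul_ne_zero (div_ne_zero h2 h1) fun h => cos_two_pi_mul_div_ne_neg_one H.odd₂ (2 * l) ?_⟩
    · exact (cos_two_pi_mul_div_eq_one_iff H.odd₂).1 (by linarith)
    · linarith

theorem cos_four_pi_injective {l l' : ℕ} (hl : 0 < l) (hl2 : 2 * l < n₂) (hl' : 0 < l')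
    (hl2' : 2 * l' < n₂) (h : Real.cos (2 * Real.pi * (2 * l : ℤ) / n₂) =
      Real.cos (2 * Real.pi * (2 * l' : ℤ) / n₂)) : l = l' := by
  have hc : IsCoprime (n₂ : ℤ) 2 := Int.isCoprime_iff_gcd_eq_one.2 (by
    simpa [Int.gcd] using (Nat.coprime_two_right.2 H.odd₂))
  rcases (cos_two_pi_mul_div_eq_iff H.odd₂).1 h with h | h
  · rw [← mul_sub] at h
    have := Int.eq_zero_of_abs_lt_dvd (hc.dvd_of_dvd_mul_left h) (by rw [abs_lt]; omega)
    omega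
  · rw [← mul_add] at h
    have := Int.eq_zero_of_abs_lt_dvd (hc.dvd_of_dvd_mul_left h) (by rw [abs_lt]; omega)
    omega

-- A coordinate confined to a window of length n is determined by its residue modulo n; the last
-- inequality in `transversal` provides the window.
omit H in
theorem eq_of_dvd_sub_of_mul_lt {n m : ℕ} {x x' : ℕ} (hd : (n : ℤ) ∣ x - x')
    (h : m * x < n * m + m * x') (h' : m * x' < n * m + m * x) : x = x' := by
  have h1 : x < n + x' := by
    refine lt_of_mul_lt_mul_left (a := m) ?_ m.zero_le
    rw [mul_add, mul_comm m n]; exact h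
  have h2 : x' < n + x := by
    refine lt_of_mul_lt_mul_left (a := m) ?_ m.zero_le
    rw [mul_add, mul_comm m n]; exact h'
  have := Int.eq_zero_of_abs_lt_dvd hd (by rw [abs_lt]; omega)
  omega

theorem alpha_sq_injective {P Q : ℕ ×ₗ ℕ} (hP : P ∈ transversal n₁ n₂) (hPk : (ofLex P).1 ≠ n₁)
    (hQ : Q ∈ transversal n₁ n₂) (hQk : (ofLex Q).1 ≠ n₁)
    (h : alpha n₁ n₂ n₃ 0 ψ P ^ 2 = alpha n₁ n₂ n₃ 0 ψ Q ^ 2) : P = Q := by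
  obtain ⟨k, l, rfl⟩ := exists_eq_toLex P
  obtain ⟨k', l', rfl⟩ := exists_eq_toLex Q
  obtain ⟨hd, ⟨a, b, c, d⟩ | ⟨a, ⟨b, c, hl⟩, d⟩⟩ := H.transversal_cases hP hPk <;>
  obtain ⟨hd', ⟨a', b', c', d'⟩ | ⟨a', ⟨b', c', hl'⟩, d'⟩⟩ := H.transversal_cases hQ hQk
  · rw [H.alpha_sq_typeI a hd, H.alpha_sq_typeI a' hd'] at h
    obtain ⟨h1, h2⟩ := eq_of_typeI_eq H.odd₁ H.odd₂ h
    have hk : k = k' := by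
      rcases (cos_two_pi_mul_div_eq_iff H.odd₁).1 h1 with h | h
      · have := Int.eq_zero_of_abs_lt_dvd h (by rw [abs_lt]; omega)
        omega
      · have := Int.eq_zero_of_abs_lt_dvd h (by rw [abs_lt]; omega)
        omega
    subst hk
    have hc : IsCoprime (n₂ : ℤ) 2 := Int.isCoprime_iff_gcd_eq_one.2 (by
      simpa [Int.gcd] using (Nat.coprime_two_right.2 H.odd₂))
    rw [← mul_sub] at h2
    rw [eq_of_dvd_sub_of_mul_lt (m := n₁) (hc.dvd_of_dvd_mul_left h2)
      (by rw [mul_comm n₂ n₁]; omega) (by rw [mul_comm n₂ n₁]; omega)]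
  · rw [H.alpha_sq_typeI a hd, H.alpha_sq_typeII a'] at h
    exact absurd h (typeI_ne_typeII H.odd₁ H.odd₂ H.coprime H.coprime_three hd' hl')
  · rw [H.alpha_sq_typeI a' hd', H.alpha_sq_typeII a] at h
    exact absurd h.symm (typeI_ne_typeII H.odd₁ H.odd₂ H.coprime H.coprime_three hd hl)
  · rw [H.alpha_sq_typeII a, H.alpha_sq_typeII a', mul_div_assoc', mul_div_assoc',
      div_left_inj' two_ne_zero] at h
    obtain ⟨h1, h2⟩ := eq_of_typeII_eq H.odd₁ H.odd₂ hd hd' hl hl' h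
    have hll := H.cos_four_pi_injective b c b' c' h2
    subst hll
    rw [eq_of_dvd_sub_of_mul_lt (m := n₂) h1 (by omega) (by omega)]

/-- The absolute value of `lowestCoeff` as a product. -/
theorem abs_lowestCoeff (p : ℕ ×ₗ ℕ → Prop) [DecidablePred p]
    (hp : ∀ P ∈ transversal n₁ n₂, p (partner n₁ n₂ P) ↔ p P) (φ : ℝ) :
    |lowestCoeff n₁ n₂ n₃ φ ψ ((nodes n₁ n₂).filter p)| =
      |∏ n ∈ Finset.Icc 1 ((nodes n₁ n₂).filter p).card, lagrangeCoeff n| *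
      ((∏ P ∈ (transversal n₁ n₂).filter p,
        2 * (alpha n₁ n₂ n₃ φ ψ P ^ 2 * |beta n₁ n₂ n₃ φ ψ P|)) *
      ∏ P ∈ (transversal n₁ n₂).filter p, ∏ Q ∈ (transversal n₁ n₂).filter p,
        if P = Q then 1 else |alpha n₁ n₂ n₃ φ ψ P ^ 2 - alpha n₁ n₂ n₃ φ ψ Q ^ 2|) := by
  have hab := fun P hP => alpha_beta_partner H.pos₁ H.pos₂ H.coprime H.odd₂ H.even₃ φ ψ (P := P) hP
  have hmem := fun P hP => partner_mem_nodes H.pos₁ H.pos₂ H.coprime (P := P) hP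
  rw [lowestCoeff, abs_mul]
  congr 1
  refine abs_det_of_pairing (τ := partner n₁ n₂) ?_ ?_ ?_ ?_ ?_ ?_ ?_
  · exact Finset.filter_subset_filter _ transversal_subset
  · intro P hP
    rw [Finset.mem_filter] at hP ⊢
    exact ⟨(hmem P hP.1).1, (hp P hP.1).2 hP.2⟩
  · intro P hP hP'
    rw [Finset.mem_filter] at hP hP'
    exact (hmem P hP.1).2 hP'.1
  · exact (partner_injOn H.pos₁ H.pos₂ H.coprime).mono (by simp [Set.subset_def]; tauto)
  · intro P hP hPT
    rw [Finset.mem_filter] at hP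
    obtain ⟨Q, hQ, rfl⟩ := exists_partner_eq H.pos₁ H.pos₂ H.coprime H.odd₁ H.odd₂ hP.1
      fun h => hPT (Finset.mem_filter.2 ⟨h, hP.2⟩)
    exact ⟨Q, Finset.mem_filter.2 ⟨hQ, (hp Q hQ).1 hP.2⟩, rfl⟩
  · exact fun P hP => (hab P (Finset.mem_filter.1 hP).1).1
  · exact fun P hP => (hab P (Finset.mem_filter.1 hP).1).2

/-- The pairing preserves the singular nodes k = n₁ and so restricts to the regular ones. -/
theorem partner_fst_ne_iff {P : ℕ ×ₗ ℕ} (hP : P ∈ transversal n₁ n₂) :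
    (ofLex (partner n₁ n₂ P)).1 ≠ n₁ ↔ (ofLex P).1 ≠ n₁ := by
  obtain ⟨k, l, rfl⟩ := exists_eq_toLex P
  have hpos := ((toLex_mem_transversal H.pos₁ H.pos₂).1 hP).1
  have j1 : n₂ * k < n₁ * n₂ ↔ k < n₁ := by rw [mul_comm n₁, Nat.mul_lt_mul_left H.pos₂]
  rcases partner_cases H.pos₁ H.pos₂ H.coprime hP with ⟨a, b, c, e⟩ | ⟨a, b, c, d, e⟩ |
    ⟨a, b, c, e⟩ | ⟨a, b, c, d, e⟩ <;>
  · rw [e]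
    simp only [ofLex_toLex]
    all_goals omega

theorem lowestCoeff_regularNodes_ne_zero :
    lowestCoeff n₁ n₂ n₃ 0 ψ (regularNodes n₁ n₂) ≠ 0 := by
  rw [← abs_ne_zero, regularNodes, H.abs_lowestCoeff _ fun P hP => H.partner_fst_ne_iff hP]
  refine mul_ne_zero (abs_ne_zero.2 (Finset.prod_ne_zero_iff.2 fun n hn =>
    lagrangeCoeff_ne_zero (by have := (Finset.mem_Icc.1 hn).1; omega))) (mul_ne_zero ?_ ?_)
  · refine Finset.prod_ne_zero_iff.2 fun P hP => ?_
    have := H.alpha_beta_ne_zero (Finset.mem_filter.1 hP).1 (Finset.mem_filter.1 hP).2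
    exact mul_ne_zero two_ne_zero (mul_ne_zero (pow_ne_zero 2 this.1) (abs_ne_zero.2 this.2))
  · refine Finset.prod_ne_zero_iff.2 fun P hP => Finset.prod_ne_zero_iff.2 fun Q hQ => ?_
    rw [Finset.mem_filter] at hP hQ
    split_ifs with hPQ
    · exact one_ne_zero
    · exact abs_ne_zero.2 (sub_ne_zero.2 fun h =>
        hPQ (H.alpha_sq_injective hP.1 hP.2 hQ.1 hQ.2 h))

end Admissible

/-! ### The limit φ → 0. -/

/-- A product tends to infinity if one factor does and the others are bounded below by positive
constants. -/
theorem tendsto_mul_prod_atTop {ι κ : Type*} {F : Filter κ} (s : Finset ι) {f : ι → κ → ℝ}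
    {g : κ → ℝ} (hg : Tendsto g F atTop) (hf : ∀ i ∈ s, ∃ c > 0, ∀ᶠ x in F, c ≤ f i x) :
    Tendsto (fun x => g x * ∏ i ∈ s, f i x) F atTop := by
  classical
  induction s using Finset.induction_on with
  | empty => simpa using hg
  | insert a s ha ih =>
    obtain ⟨c, hc, hfc⟩ := hf a (by simp)
    have h := (ih fun i hi => hf i (by simp [hi]))
    refine tendsto_atTop_mono' F ?_ (h.atTop_mul_const hc)
    filter_upwards [hfc, h.eventually_ge_atTop 0] with x h1 h2
    rw [Finset.prod_insert ha]
    calc (g x * ∏ i ∈ s, f i x) * c ≤ (g x * ∏ i ∈ s, f i x) * f a x :=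
          mul_le_mul_of_nonneg_left h1 h2
      _ = _ := by ring

theorem exists_lower_bound_of_tendsto {κ : Type*} {F : Filter κ} {f : κ → ℝ} {a : ℝ} (ha : 0 < a)
    (h : Tendsto f F (𝓝 a)) : ∃ c > 0, ∀ᶠ x in F, c ≤ f x :=
  ⟨a / 2, by positivity, h.eventually (eventually_ge_nhds (by linarith))⟩

theorem exists_lower_bound_of_atTop {κ : Type*} {F : Filter κ} {f : κ → ℝ}
    (h : Tendsto f F atTop) : ∃ c > 0, ∀ᶠ x in F, c ≤ f x :=
  ⟨1, one_pos, h.eventually_ge_atTop 1⟩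

namespace Admissible

variable {n₁ n₂ n₃ : ℕ} {ψ : ℝ} (H : Admissible n₁ n₂ n₃ ψ)
include H

theorem continuousAt_amplitude {P : ℕ ×ₗ ℕ} (hP : P ∈ transversal n₁ n₂)
    (hk : (ofLex P).1 ≠ n₁) : ContinuousAt (fun φ => amplitude n₁ n₂ n₃ φ ψ P) 0 := by
  obtain ⟨k, l, rfl⟩ := exists_eq_toLex P
  have r₁ := H.cast_ne₁
  obtain ⟨hd, ⟨a, -⟩ | ⟨a, -⟩⟩ := H.transversal_cases hP hk
  · simp only [amplitude_of_typeI a]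
    exact continuousAt_const
  · simp only [amplitude_of_typeII a]
    refine continuousAt_const.mul (ContinuousAt.div (by fun_prop) (by fun_prop) ?_)
    have e' : 2 * Real.pi * n₂ * ((k : ℝ) / (2 * n₁) + 0) = Real.pi * (n₂ * k / n₁) := by
      field_simp; ring
    rw [e', ← pow_ne_zero_iff two_ne_zero, H.sin_sq_denominator]
    exact div_ne_zero (H.one_sub_cos_ne_zero hd) two_ne_zero

theorem tendsto_alpha_beta {P : ℕ ×ₗ ℕ} (hP : P ∈ transversal n₁ n₂) (hk : (ofLex P).1 ≠ n₁) :
    Tendsto (fun φ => alpha n₁ n₂ n₃ φ ψ P) (𝓝[≠] 0) (𝓝 (alpha n₁ n₂ n₃ 0 ψ P)) ∧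
    Tendsto (fun φ => beta n₁ n₂ n₃ φ ψ P) (𝓝[≠] 0) (𝓝 (beta n₁ n₂ n₃ 0 ψ P)) := by
  have h := H.continuousAt_amplitude hP hk
  exact ⟨((h.mul continuousAt_const).tendsto).mono_left nhdsWithin_le_nhds,
    ((h.mul continuousAt_const).tendsto).mono_left nhdsWithin_le_nhds⟩

theorem singular_cases {P : ℕ ×ₗ ℕ} (hP : P ∈ transversal n₁ n₂) (hk : (ofLex P).1 = n₁) :
    ∃ l : ℕ, P = toLex (n₁, l) ∧ n₁ * l < n₂ * n₁ ∧ 0 < l ∧ 2 * l < n₂ := by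
  obtain ⟨k, l, rfl⟩ := exists_eq_toLex P
  obtain rfl : k = n₁ := hk
  obtain ⟨⟨h1, h2⟩, ⟨a, b, c⟩ | ⟨a, b, c⟩⟩ := (toLex_mem_transversal H.pos₁ H.pos₂).1 hP
  · omega
  · exact ⟨l, rfl, a, h2, b⟩

omit H in
/-- The square of the amplitude at the nodes `(n₁, l)`. -/
theorem amplitude_sq_singular {l : ℕ} (hl : n₁ * l < n₂ * n₁) (φ : ℝ) :
    amplitude n₁ n₂ n₃ φ ψ (toLex (n₁, l)) ^ 2 = amplitude n₁ n₂ n₃ φ ψ (toLex (n₁, 0)) ^ 2 := by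
  rw [amplitude_of_typeII hl, amplitude_of_typeII (by omega), mul_pow, mul_pow, neg_one_pow_sq,
    neg_one_pow_sq]

/-- The pair (n₁, 0) is not a node; it stands for the squared amplitude common to all (n₁, l). The
squared numerator tends to sin²(πn₃ + π/4) = 1/2, while the denominator has a simple zero at φ = 0.
-/
theorem tendsto_amplitude_sq_singular :
    Tendsto (fun φ => amplitude n₁ n₂ n₃ φ ψ (toLex (n₁, 0)) ^ 2) (𝓝[≠] 0) atTop := by
  have r₁ := H.cast_ne₁
  have r₂ := H.cast_ne₂
  have hII : n₁ * 0 < n₂ * n₁ := by rw [mul_zero]; exact Nat.mul_pos H.pos₂ H.pos₁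
  have hden0 : Real.sin (2 * Real.pi * n₂ * ((n₁ : ℝ) / (2 * n₁) + 0)) = 0 := by
    rw [show 2 * Real.pi * n₂ * ((n₁ : ℝ) / (2 * n₁) + 0) = n₂ * Real.pi by field_simp; ring,
      Real.sin_nat_mul_pi]
  have hnum0 : Real.sin (2 * Real.pi * n₃ * ((n₁ : ℝ) / (2 * n₁) + 0 + ψ)) ^ 2 = 1 / 2 := by
    obtain ⟨m, hm⟩ := H.even₃.two_dvd
    have : 2 * (2 * Real.pi * n₃ * ((n₁ : ℝ) / (2 * n₁) + 0 + ψ)) =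
        Real.pi / 2 + n₃ * (2 * Real.pi) := by
      have e : 2 * (2 * Real.pi * n₃ * ((n₁ : ℝ) / (2 * n₁) + 0 + ψ)) =
        2 * (2 * Real.pi * n₃ * ψ) + n₃ * (2 * Real.pi) := by field_simp; ring
      rw [e, H.hψ]; ring
    rw [Real.sin_sq_eq_half_sub, this, Real.cos_add_nat_mul_two_pi, Real.cos_pi_div_two]
    norm_num
  have hnum : Tendsto (fun φ : ℝ => Real.sin (2 * Real.pi * n₃ * ((n₁ : ℝ) / (2 * n₁) + φ + ψ)) ^ 2)
      (𝓝[≠] 0) (𝓝 (1 / 2)) := by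
    rw [← hnum0]
    have : Continuous fun φ : ℝ =>
        Real.sin (2 * Real.pi * n₃ * ((n₁ : ℝ) / (2 * n₁) + φ + ψ)) ^ 2 := by fun_prop
    exact (this.tendsto 0).mono_left nhdsWithin_le_nhds
  have hden : Tendsto (fun φ : ℝ => Real.sin (2 * Real.pi * n₂ * ((n₁ : ℝ) / (2 * n₁) + φ)) ^ 2)
      (𝓝[≠] 0) (𝓝[>] 0) := by
    refine tendsto_nhdsWithin_iff.2 ⟨?_, ?_⟩
    · have : Continuous fun φ : ℝ =>
          Real.sin (2 * Real.pi * n₂ * ((n₁ : ℝ) / (2 * n₁) + φ)) ^ 2 := by fun_prop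
      have := (this.tendsto 0).mono_left (nhdsWithin_le_nhds (s := {0}ᶜ))
      rwa [hden0, zero_pow two_ne_zero] at this
    · have hd := (Real.hasDerivAt_sin (2 * Real.pi * n₂ * ((n₁ : ℝ) / (2 * n₁) + 0))).comp 0
        (((hasDerivAt_id (0 : ℝ)).const_add ((n₁ : ℝ) / (2 * n₁))).const_mul (2 * Real.pi * n₂))
      have hcos : Real.cos (2 * Real.pi * n₂ * ((n₁ : ℝ) / (2 * n₁) + 0)) ≠ 0 := by
        intro h
        have := Real.sin_sq_add_cos_sq (2 * Real.pi * n₂ * ((n₁ : ℝ) / (2 * n₁) + 0))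
        rw [h, hden0] at this
        norm_num at this
      have hne := hd.eventually_ne (c := 0)
        (mul_ne_zero hcos (mul_ne_zero (mul_ne_zero (by positivity) r₂) one_ne_zero))
      filter_upwards [hne] with φ hφ
      have h : Real.sin (2 * Real.pi * n₂ * ((n₁ : ℝ) / (2 * n₁) + φ)) ≠ 0 := hφ
      exact Set.mem_Ioi.2 (by positivity)
  have := hnum.pos_mul_atTop (by norm_num) hden.inv_tendsto_nhdsGT_zero
  refine this.congr fun φ => ?_
  rw [amplitude_of_typeII hII, mul_pow, neg_one_pow_sq, one_mul, div_pow, div_eq_mul_inv]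
  rfl

/-- The phase does not depend on φ, and neither its sine nor its cosine vanishes. -/
theorem tendsto_singular_alpha_sq {P : ℕ ×ₗ ℕ} (hP : P ∈ transversal n₁ n₂)
    (hk : (ofLex P).1 = n₁) :
    Tendsto (fun φ => alpha n₁ n₂ n₃ φ ψ P ^ 2) (𝓝[≠] 0) atTop ∧
    Tendsto (fun φ => |beta n₁ n₂ n₃ φ ψ P|) (𝓝[≠] 0) atTop := by
  obtain ⟨l, rfl, a, hl, hl2⟩ := H.singular_cases hP hk
  have hndvd : ¬ (n₂ : ℤ) ∣ 2 * l := by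
    have : ((2 * l : ℤ)) = ((2 * l : ℕ) : ℤ) := by push_cast; rfl
    rw [this, Int.natCast_dvd_natCast]
    intro h
    have := Nat.le_of_dvd (by omega) h
    omega
  have h1 : Real.cos (2 * Real.pi * (2 * l : ℤ) / n₂) < 1 :=
    lt_of_le_of_ne (Real.cos_le_one _) fun h => hndvd ((cos_two_pi_mul_div_eq_one_iff H.odd₂).1 h)
  have h2 : -1 < Real.cos (2 * Real.pi * (2 * l : ℤ) / n₂) :=
    lt_of_le_of_ne (Real.neg_one_le_cos _) (cos_two_pi_mul_div_ne_neg_one H.odd₂ _).symm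
  constructor
  · simp only [alpha_sq_eq, H.cos_two_mul_phase_typeII a, amplitude_sq_singular a]
    exact H.tendsto_amplitude_sq_singular.atTop_mul_const (by linarith)
  · have h : Tendsto (fun φ => beta n₁ n₂ n₃ φ ψ (toLex (n₁, l)) ^ 2) (𝓝[≠] 0) atTop := by
      simp only [beta_sq_eq, H.cos_two_mul_phase_typeII a, amplitude_sq_singular a]
      exact H.tendsto_amplitude_sq_singular.atTop_mul_const (by linarith)
    refine (Real.tendsto_sqrt_atTop.comp h).congr fun φ => ?_
    simp [Real.sqrt_sq_eq_abs]

/-- For two singular nodes the difference is the diverging common squared amplitude times a nonzero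
constant. If just one is singular it diverges too, and for two regular nodes it has a nonzero limit
by `alpha_sq_injective`. -/
theorem exists_lower_bound_abs_sub {P Q : ℕ ×ₗ ℕ} (hP : P ∈ transversal n₁ n₂)
    (hQ : Q ∈ transversal n₁ n₂) (hPQ : P ≠ Q) : ∃ c > 0, ∀ᶠ φ in 𝓝[≠] (0 : ℝ),
      c ≤ |alpha n₁ n₂ n₃ φ ψ P ^ 2 - alpha n₁ n₂ n₃ φ ψ Q ^ 2| := by
  have mixed : ∀ {P Q : ℕ ×ₗ ℕ}, P ∈ transversal n₁ n₂ → Q ∈ transversal n₁ n₂ →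
      (ofLex P).1 = n₁ → (ofLex Q).1 ≠ n₁ → ∃ c > 0, ∀ᶠ φ in 𝓝[≠] (0 : ℝ),
      c ≤ |alpha n₁ n₂ n₃ φ ψ P ^ 2 - alpha n₁ n₂ n₃ φ ψ Q ^ 2| := by
    intro P Q hP hQ hPk hQk
    have h1 := (H.tendsto_singular_alpha_sq hP hPk).1
    have h2 := ((H.tendsto_alpha_beta hQ hQk).1.pow 2).neg
    exact exists_lower_bound_of_atTop
      (tendsto_abs_atTop_atTop.comp (by simpa [sub_eq_add_neg] using h1.atTop_add h2))
  by_cases hPk : (ofLex P).1 = n₁ <;> by_cases hQk : (ofLex Q).1 = n₁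
  · obtain ⟨l, rfl, a, hl, hl2⟩ := H.singular_cases hP hPk
    obtain ⟨l', rfl, a', hl', hl2'⟩ := H.singular_cases hQ hQk
    have hne : Real.cos (2 * Real.pi * (2 * l : ℤ) / n₂) ≠
        Real.cos (2 * Real.pi * (2 * l' : ℤ) / n₂) := fun h =>
      hPQ (by rw [H.cos_four_pi_injective hl hl2 hl' hl2' h])
    refine exists_lower_bound_of_atTop ?_
    have hpos : 0 < |(Real.cos (2 * Real.pi * (2 * l' : ℤ) / n₂) -
        Real.cos (2 * Real.pi * (2 * l : ℤ) / n₂)) / 2| := by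
      rw [abs_pos]
      exact div_ne_zero (sub_ne_zero.2 hne.symm) two_ne_zero
    refine (H.tendsto_amplitude_sq_singular.atTop_mul_const hpos).congr fun φ => ?_
    simp only [alpha_sq_eq, H.cos_two_mul_phase_typeII a, H.cos_two_mul_phase_typeII a',
      amplitude_sq_singular a, amplitude_sq_singular a']
    rw [← abs_of_nonneg (sq_nonneg (amplitude n₁ n₂ n₃ φ ψ (toLex (n₁, 0)))), ← abs_mul]
    rw [abs_of_nonneg (sq_nonneg (amplitude n₁ n₂ n₃ φ ψ (toLex (n₁, 0))))]
    congr 1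
    ring
  · exact mixed hP hQ hPk hQk
  · simp only [abs_sub_comm (alpha n₁ n₂ n₃ _ ψ P ^ 2)]
    exact mixed hQ hP hQk hPk
  · exact exists_lower_bound_of_tendsto
      (abs_pos.2 (sub_ne_zero.2 fun h => hPQ (H.alpha_sq_injective hP hPk hQ hQk h)))
      (((H.tendsto_alpha_beta hP hPk).1.pow 2).sub ((H.tendsto_alpha_beta hQ hQk).1.pow 2)).abs

theorem singular_tendsto_weight {P : ℕ ×ₗ ℕ} (hP : P ∈ transversal n₁ n₂)
    (hk : (ofLex P).1 = n₁) : Tendsto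
      (fun φ => 2 * (alpha n₁ n₂ n₃ φ ψ P ^ 2 * |beta n₁ n₂ n₃ φ ψ P|)) (𝓝[≠] 0) atTop := by
  obtain ⟨h1, h2⟩ := H.tendsto_singular_alpha_sq hP hk
  exact (h1.atTop_mul_atTop₀ h2).const_mul_atTop two_pos

theorem exists_lower_bound_weight {P : ℕ ×ₗ ℕ} (hP : P ∈ transversal n₁ n₂) :
    ∃ c > 0, ∀ᶠ φ in 𝓝[≠] (0 : ℝ),
      c ≤ 2 * (alpha n₁ n₂ n₃ φ ψ P ^ 2 * |beta n₁ n₂ n₃ φ ψ P|) := by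
  by_cases hk : (ofLex P).1 = n₁
  · exact exists_lower_bound_of_atTop (H.singular_tendsto_weight hP hk)
  · obtain ⟨h1, h2⟩ := H.tendsto_alpha_beta hP hk
    have hne := H.alpha_beta_ne_zero hP hk
    refine exists_lower_bound_of_tendsto ?_ (((h1.pow 2).mul h2.abs).const_mul 2)
    have := hne.1
    have := hne.2
    positivity

theorem toLex_mem_transversal_singular : toLex (n₁, 1) ∈ transversal n₁ n₂ := by
  have h2 : 2 * 1 < n₂ := by
    have := H.one_lt₂
    obtain ⟨m, hm⟩ := H.odd₂
    omega
  rw [toLex_mem_transversal H.pos₁ H.pos₂]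
  refine ⟨⟨H.pos₁, one_pos⟩, Or.inr ⟨?_, h2, ?_⟩⟩
  · rw [mul_comm n₂]
    exact Nat.mul_lt_mul_of_pos_left H.one_lt₂ H.pos₁
  · have := H.pos₁
    rw [mul_comm n₂]
    omega

/-- The weight of the node (n₁, 1) supplies the diverging factor. -/
theorem tendsto_abs_lowestCoeff_nodes :
    Tendsto (fun φ => |lowestCoeff n₁ n₂ n₃ φ ψ (nodes n₁ n₂)|) (𝓝[≠] 0) atTop := by
  have habs := H.abs_lowestCoeff (fun _ => True) fun _ _ => Iff.rfl
  simp only [Finset.filter_true] at habs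
  simp only [habs]
  have hc : 0 < |∏ n ∈ Finset.Icc 1 (nodes n₁ n₂).card, lagrangeCoeff n| :=
    abs_pos.2 (Finset.prod_ne_zero_iff.2 fun n hn =>
      lagrangeCoeff_ne_zero (by have := (Finset.mem_Icc.1 hn).1; omega))
  refine Tendsto.const_mul_atTop hc ?_
  have hmem := H.toLex_mem_transversal_singular
  refine (tendsto_mul_prod_atTop (transversal n₁ n₂ ×ˢ transversal n₁ n₂)
    (f := fun x φ => if x.1 = x.2 then 1 else
      |alpha n₁ n₂ n₃ φ ψ x.1 ^ 2 - alpha n₁ n₂ n₃ φ ψ x.2 ^ 2|)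
    (tendsto_mul_prod_atTop ((transversal n₁ n₂).erase (toLex (n₁, 1)))
      (f := fun P φ => 2 * (alpha n₁ n₂ n₃ φ ψ P ^ 2 * |beta n₁ n₂ n₃ φ ψ P|))
      (H.singular_tendsto_weight hmem rfl)
      fun P hP => H.exists_lower_bound_weight (Finset.mem_of_mem_erase hP)) ?_).congr fun φ => ?_
  · rintro ⟨P, Q⟩ hPQ
    rw [Finset.mem_product] at hPQ
    by_cases h : P = Q
    · exact ⟨1, one_pos, by simp [h]⟩
    · simpa [h] using H.exists_lower_bound_abs_sub hPQ.1 hPQ.2 h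
  · rw [Finset.prod_product, Finset.mul_prod_erase _
      (fun P => 2 * (alpha n₁ n₂ n₃ φ ψ P ^ 2 * |beta n₁ n₂ n₃ φ ψ P|)) hmem]

end Admissible

end LissajousNodes

end

theorem mainTheorem5 (n₁ n₂ n₃ : ℕ) (ψ : ℝ)
    (hn₁ : n₁.Prime) (hn₁_odd : Odd n₁) (hn₂ : n₂.Prime) (hn₂_odd : Odd n₂)
    (hn₃_even : Even n₃) (h₁₂ : Nat.Coprime n₁ n₂) (h₁₃ : Nat.Coprime n₁ n₃)
    (h₂₃ : Nat.Coprime n₂ n₃)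
    (h_mod₁ : n₂ ≡ 1 [MOD n₁]) (h_mod₂ : n₃ ≡ 2 [MOD n₁]) (h_mod₃ : n₃ ≡ 2 [MOD n₂])
    (hψ : 2 * Real.pi * n₃ * ψ = Real.pi / 4) :
    -- all nodes, as `φ` tends to `0`
    ((∀ᶠ φ in 𝓝[≠] (0 : ℝ),
        LissajousNodes.WronskianHasLowestTerm n₁ n₂ n₃ φ ψ (LissajousNodes.nodes n₁ n₂)
          ((LissajousNodes.nodes n₁ n₂).card / 2)
          (LissajousNodes.lowestCoeff n₁ n₂ n₃ φ ψ (LissajousNodes.nodes n₁ n₂)) ∧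
        LissajousNodes.lowestCoeff n₁ n₂ n₃ φ ψ (LissajousNodes.nodes n₁ n₂) ≠ 0) ∧
      Tendsto
        (fun φ : ℝ => |LissajousNodes.lowestCoeff n₁ n₂ n₃ φ ψ (LissajousNodes.nodes n₁ n₂)|)
        (𝓝[≠] 0) atTop) ∧
    -- the nodes whose amplitude is defined at `φ = 0`, at `φ = 0`
    (LissajousNodes.WronskianHasLowestTerm n₁ n₂ n₃ 0 ψ (LissajousNodes.regularNodes n₁ n₂)
        ((LissajousNodes.regularNodes n₁ n₂).card / 2)
        (LissajousNodes.lowestCoeff n₁ n₂ n₃ 0 ψ (LissajousNodes.regularNodes n₁ n₂)) ∧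
      LissajousNodes.lowestCoeff n₁ n₂ n₃ 0 ψ (LissajousNodes.regularNodes n₁ n₂) ≠ 0) := by
  -- If n₂ were 3, then n₂ ≡ 1 mod n₁ would make the odd prime n₁ divide 2.
  have h3 : n₂.Coprime 3 := by
    rw [Nat.coprime_primes hn₂ Nat.prime_three]
    rintro rfl
    have h2 : n₁ ∣ 3 - 1 := (Nat.modEq_iff_dvd' (by norm_num)).1 h_mod₁.symm
    have := (Nat.prime_dvd_prime_iff_eq hn₁ Nat.prime_two).1 h2
    subst this
    exact absurd hn₁_odd (by decide)
  have H : LissajousNodes.Admissible n₁ n₂ n₃ ψ :=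
    ⟨hn₁_odd, hn₂_odd, hn₃_even, hn₂.one_lt, h₁₂, h3, h_mod₁, h_mod₂, h_mod₃, hψ⟩
  have hlim := H.tendsto_abs_lowestCoeff_nodes
  refine ⟨⟨?_, hlim⟩, ?_⟩
  · filter_upwards [hlim.eventually_gt_atTop 0] with φ hφ
    have hne := abs_pos.1 hφ
    exact ⟨LissajousNodes.wronskianHasLowestTerm_of_lowestCoeff_ne_zero hne, hne⟩
  · have hne := H.lowestCoeff_regularNodes_ne_zero
    exact ⟨LissajousNodes.wronskianHasLowestTerm_of_lowestCoeff_ne_zero hne, hne⟩
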